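/- **Definitions.** Let $k\ge 1$ be real. Manifolds are smooth; parameter manifolds $M$ are smooth Banach manifolds (regular Hausdorff, modelled on a real Banach space). A *$k$-integrable statistical model* $(M,\Omega,\mu,p)$ consists of such an $M$, a measurable space $\Omega$ with a $\sigma$-finite measure $\mu$, and a map $p$ sending $x\in M$ to a probability measure $p(x)=\bar p(x,\cdot)\,\mu$, continuous for the $L^1$-topology, with a density potential $\bar p$ such that: for $\mu$-almost every $\omega$, $\bar p(\cdot,\omega)>0$ on $M$ and $x\mapsto\ln\bar p(x,\omega)$ is continuously Gâteaux-differentiable on $M$ (the derivative is linear on each $T_xM$ and continuous on $TM$); and for each continuous vector field $V$ on $M$, $\partial_V\ln\bar p(x,\cdot)\in L^k(\Omega,p(x))$, with $L^k(\Omega,p(x))$-norm continuous in $x$. Its Fisher metric is $$g^F(V,W)_x=\int_\Omega \partial_V\ln\bar p(x,\omega)\,\partial_W\ln\bar p(x,\omega)\,dp(x)(\omega);$$ the value $g^F(V,V)_x\in[0,\infty]$ is always defined, and it is finite if $k\ge2$. A *Markov transition* $T$ from $\Omega_1$ to $\Omega_2$ assigns to each $\omega_1\in\Omega_1$ a probability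 measure $T(\omega_1)$ on $\Omega_2$, measurably in $\omega_1$; put $T_*\nu(A)=\int T(\omega_1)(A)\,d\nu(\omega_1)$. A *representable restricted Markov morphism* from $(M,\Omega_1,\mu_1,p_1)$ to $(M,\Omega_2,\mu_2,p_2)$ is a pair $(f,T_*)$ with $f:M\to M$ a $C^1$-diffeomorphism, $p_2(f(x))=T_*(p_1(x))$ for all $x\in M$, and $T(\omega_1)=\Pi(\omega_1,\cdot)\,\mu_2$ for all $\omega_1$, for some measurable $\Pi\ge0$ on $\Omega_1\times\Omega_2$. It is *positively representable* if $\Pi$ can be chosen with $\Pi>0$ everywhere. A *finite statistical model* is a $k$-integrable statistical model whose sample space is $\Omega_n$, a set of $n$ points, with $\mu(\{\omega\})>0$ for each point. A *local quadratic form field* $F$ assigns to each finite statistical model $(M,\Omega_n,\mu,p)$ and each $x\in M$ a symmetric bilinear form on $T_xM$ of the form $$F(V,W)_x=B_{n,p(x)}\big(\partial_V\ln\bar p(x,\cdot),\ \partial_W\ln\bar p(x,\cdot)\big),$$ where $(B_{n,\nu})$ is a family, independent of the model, of symmetric bilinear forms on $\mathbb R^{\Omega_n}$ indexed by the measures $\nu$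 on $\Omega_n$. It is *weakly continuous* if, on every finite statistical model, $x\mapsto F(V,W)_x$ is continuous for all continuous vector fields $V,W$ on $M$. It is *monotone* under a class of morphisms $(f,T_*)$ if $F(df\,V,df\,V)_{f(x)}\le F(V,V)_x$ for all morphisms of the class between finite statistical models, all $x$ and all $V\in T_xM$. **Statement.** 1. Let $\Omega_1,\Omega_2$ be finite-dimensional smooth manifolds with Borel $\sigma$-algebras, and let $\mu_1,\mu_2$ be Lebesgue probability measures on them (probability measures locally equivalent to Lebesgue measure in charts). If $(f,T_*)$ is a representable restricted Markov morphism from a $k$-integrable statistical model $(M,\Omega_1,\mu_1,p_1)$ to a $k$-integrable statistical model $(M,\Omega_2,\mu_2,p_2)$, with Fisher metrics $g_1^F$ and $g_2^F$, then for all $x\in M$ and $V\in T_xM$ $$g^F_2(df\,V,df\,V)_{f(x)}\le g^F_1(V,V)_x$$ in $[0,\infty]$ (hence an inequality of real numbers if $k\ge2$). 2. On finite statistical models the Fisher metric is a weakly continuous local quadratic form field that is monotone under representable restricted Markov morphisms, and it is the unique one up to a constant: if $F$ is a weakly continuous local quadratic form field that is monotone under positively representable restricted Markov morphisms (in particular,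 if it is monotone under all representable ones), then there is a constant $c\in\mathbb R$ with $F=c\,g^F$ on all finite statistical models. -/

import Mathlib

open MeasureTheory ProbabilityTheory
open scoped Manifold ContDiff

universe u

noncomputable section

namespace InfoGeo

section Gateaux

variable {E : Type*} [NormedAddCommGroup E] [NormedSpace ℝ E]
  {M : Type*} [TopologicalSpace M] [ChartedSpace E M]

/-- The Gâteaux derivative `∂_V F` of `F : M → ℝ` at `x` in the direction `V ∈ T_x M`. Tangent
vectors at `x` are, in Mathlib, written in the coordinates of the preferred chart at `x`. -/
def gateauxDeriv (F : M → ℝ) (x : M) (V : TangentSpace 𝓘(ℝ, E) x) : ℝ :=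
  lineDeriv ℝ (F ∘ (chartAt E x).symm) (chartAt E x x) (show E from V)

/-- `F : M → ℝ` is continuously Gâteaux-differentiable: in every chart it has directional
derivatives in all directions, and `V ↦ ∂_V F` is linear on each `T_x M` and continuous on `TM`. -/
structure IsContGateauxDiff [IsManifold 𝓘(ℝ, E) ∞ M] (F : M → ℝ) : Prop where
  hasLineDerivAt : ∀ e ∈ IsManifold.maximalAtlas 𝓘(ℝ, E) ∞ M, ∀ x ∈ e.source,
    ∀ V : TangentSpace 𝓘(ℝ, E) x,
      HasLineDerivAt ℝ (F ∘ e.symm) (gateauxDeriv F x V) (e x)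
        (show E from mfderiv 𝓘(ℝ, E) 𝓘(ℝ, E) e x V)
  isLinearMap : ∀ x : M, IsLinearMap ℝ (fun V : TangentSpace 𝓘(ℝ, E) x => gateauxDeriv F x V)
  continuous_deriv :
    Continuous (fun v : TangentBundle 𝓘(ℝ, E) M => gateauxDeriv F v.proj v.snd)

/-- Continuous vector fields on `M`. -/
def IsContVectorField [IsManifold 𝓘(ℝ, E) ∞ M] (V : (x : M) → TangentSpace 𝓘(ℝ, E) x) : Prop :=
  Continuous (fun x => (⟨x, V x⟩ : TangentBundle 𝓘(ℝ, E) M))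

end Gateaux

section Models

/-- A `k`-integrable parametrized measure model `(M, Ω, μ, p)`, given together with a density
potential `density` as in the definition (two such potentials give, for every tangent vector `V`,
the same function `∂_V ln p̄` up to a null set). -/
structure ParametrizedMeasureModel (k : ℝ)
    (E : Type*) [NormedAddCommGroup E] [NormedSpace ℝ E]
    (M : Type*) [TopologicalSpace M] [ChartedSpace E M] [IsManifold 𝓘(ℝ, E) ∞ M]
    (Ω : Type*) [MeasurableSpace Ω] where
  /-- the reference measure -/
  μ : Measure Ω
  sigmaFinite : SigmaFinite μ
  /-- the family of measures -/
  p : M → Measure Ω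
  /-- the density potential `p̄(x, ω)` -/
  density : M → Ω → ℝ
  integrable_density : ∀ x, Integrable (density x) μ
  p_eq : ∀ x, p x = μ.withDensity (fun w => ENNReal.ofReal (density x w))
  /-- `p` is continuous for the `L¹`-topology -/
  continuous_L1 : Continuous (fun x => (integrable_density x).toL1 (density x))
  /-- for almost all `ω`, `x ↦ ln p̄(x, ω)` is defined on `M` -/
  density_pos : ∀ᵐ w ∂μ, ∀ x, 0 < density x w
  /-- for almost all `ω`, `x ↦ ln p̄(x, ω)` is continuously Gâteaux-differentiable on `M` -/
  gateaux : ∀ᵐ w ∂μ, IsContGateauxDiff (E := E) (fun x : M => Real.log (density x w))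
  /-- `∂_V ln p̄(x, ·) ∈ L^k(Ω, p(x))` for every continuous vector field `V` -/
  memLp : ∀ V : (x : M) → TangentSpace 𝓘(ℝ, E) x, IsContVectorField V → ∀ x,
    MemLp (fun w => gateauxDeriv (fun y => Real.log (density y w)) x (V x))
      (ENNReal.ofReal k) (p x)
  /-- the `L^k(Ω, p(x))`-norm of `∂_V ln p̄(x, ·)` is continuous in `x` -/
  continuous_norm : ∀ V : (x : M) → TangentSpace 𝓘(ℝ, E) x, IsContVectorField V →
    Continuous (fun x =>
      (eLpNorm (fun w => gateauxDeriv (fun y => Real.log (density y w)) x (V x))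
        (ENNReal.ofReal k) (p x)).toReal)

/-- A `k`-integrable statistical model: all `p(x)` are probability measures. -/
structure StatisticalModel (k : ℝ)
    (E : Type*) [NormedAddCommGroup E] [NormedSpace ℝ E]
    (M : Type*) [TopologicalSpace M] [ChartedSpace E M] [IsManifold 𝓘(ℝ, E) ∞ M]
    (Ω : Type*) [MeasurableSpace Ω] extends ParametrizedMeasureModel k E M Ω where
  isProbabilityMeasure : ∀ x, IsProbabilityMeasure (p x)

/-- A statistical model on the sample space `Ω_n` with `n` points, whose reference measure has
maximal support. -/
structure FiniteStatisticalModel (k : ℝ)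
    (E : Type*) [NormedAddCommGroup E] [NormedSpace ℝ E]
    (M : Type*) [TopologicalSpace M] [ChartedSpace E M] [IsManifold 𝓘(ℝ, E) ∞ M]
    (n : ℕ) extends StatisticalModel k E M (Fin n) where
  full_support : ∀ i : Fin n, μ {i} ≠ 0

variable {k : ℝ} {E : Type*} [NormedAddCommGroup E] [NormedSpace ℝ E]
  {M : Type*} [TopologicalSpace M] [ChartedSpace E M] [IsManifold 𝓘(ℝ, E) ∞ M]
  {Ω Ω' : Type*} [MeasurableSpace Ω] [MeasurableSpace Ω']

/-- `∂_V ln p̄(x, ω)`. -/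
def StatisticalModel.dlog (S : StatisticalModel k E M Ω) (x : M)
    (V : TangentSpace 𝓘(ℝ, E) x) (w : Ω) : ℝ :=
  gateauxDeriv (fun y => Real.log (S.density y w)) x V

/-- The Fisher quadratic form `g^F(V, W)_x = ∫ ∂_V ln p̄ ∂_W ln p̄ dp(x)`. -/
def StatisticalModel.fisher (S : StatisticalModel k E M Ω) (x : M)
    (V W : TangentSpace 𝓘(ℝ, E) x) : ℝ :=
  ∫ w, S.dlog x V w * S.dlog x W w ∂(S.p x)

/-- The value `g^F(V, V)_x ∈ [0, ∞]`, which makes sense without square-integrability. -/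
def StatisticalModel.efisher (S : StatisticalModel k E M Ω) (x : M)
    (V : TangentSpace 𝓘(ℝ, E) x) : ENNReal :=
  ∫⁻ w, ENNReal.ofReal (S.dlog x V w ^ 2) ∂(S.p x)

/-- The Markov kernel density `Π` represents the Markov transition `T` with respect to `μ'`:
`T(ω)(S) = ∫_S Π(ω, ω') dμ'(ω')`. -/
structure IsMarkovDensity (T : Kernel Ω Ω') (μ' : Measure Ω') (D : Ω → Ω' → ℝ) : Prop where
  measurable : Measurable (Function.uncurry D)
  nonneg : ∀ w w', 0 ≤ D w w'
  eq_withDensity : ∀ w, T w = μ'.withDensity (fun w' => ENNReal.ofReal (D w w'))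

/-- `T` is `μ'`-representable. -/
def IsRepresentable (T : Kernel Ω Ω') (μ' : Measure Ω') : Prop :=
  ∃ D, IsMarkovDensity T μ' D

/-- `T` is `μ'`-representable by a strictly positive Markov transition kernel. -/
def IsPositivelyRepresentable (T : Kernel Ω Ω') (μ' : Measure Ω') : Prop :=
  ∃ D, IsMarkovDensity T μ' D ∧ ∀ w w', 0 < D w w'

/-- `(f, T_*)` is a restricted Markov morphism between models over `M`: `p₂(f(x)) = T_*(p₁(x))`,
where `T_*(ν)(S) = ∫ T(ω)(S) dν(ω)`. -/
def IsRestrictedMarkovMorphism (S₁ : StatisticalModel k E M Ω) (S₂ : StatisticalModel k E M Ω')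
    (f : M → M) (T : Kernel Ω Ω') : Prop :=
  ∀ x, S₂.p (f x) = (S₁.p x).bind T

end Models

/-- A Lebesgue measure on a smooth manifold `Ω` of dimension `d`, i.e. one that is locally
equivalent to the Lebesgue measure on `ℝ^d`: in each chart it has the same null sets. -/
def IsLebesgueMeasure (d : ℕ) {Ω : Type*} [TopologicalSpace Ω]
    [ChartedSpace (EuclideanSpace ℝ (Fin d)) Ω] [MeasurableSpace Ω] (μ : Measure Ω) : Prop :=
  ∀ e ∈ IsManifold.maximalAtlas (𝓡 d) ∞ Ω, ∀ A ⊆ e.source, MeasurableSet A →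
    (μ A = 0 ↔ (volume : Measure (EuclideanSpace ℝ (Fin d))) (e '' A) = 0)

/-- An assignment, to each statistical model with finite sample space, of a function
`(V, W) ↦ F(V, W)_x` of pairs of tangent vectors at each point `x` of its parameter manifold. -/
def FiniteField (k : ℝ) : Type (u + 1) :=
  ∀ (E : Type u) [NormedAddCommGroup E] [NormedSpace ℝ E] [CompleteSpace E]
    (M : Type u) [TopologicalSpace M] [T3Space M] [ChartedSpace E M] [IsManifold 𝓘(ℝ, E) ∞ M]
    (n : ℕ) (_ : FiniteStatisticalModel k E M n) (x : M),
    TangentSpace 𝓘(ℝ, E) x → TangentSpace 𝓘(ℝ, E) x → ℝ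

namespace FiniteField

variable {k : ℝ}

/-- The Fisher metric. -/
def fisher (k : ℝ) : FiniteField.{u} k :=
  fun _ _ _ _ _ _ _ _ _ _ S x V W => S.toStatisticalModel.fisher x V W

/-- `F` is a local quadratic form field: it is induced, through `V ↦ ∂_V ln p̄`, by a field
`μ ↦ B μ` of symmetric bilinear forms on the function spaces `L²(Ω_n, μ) = ℝ^n`. -/
def IsLocalQuadratic (F : FiniteField.{u} k) : Prop :=
  ∃ B : ∀ n : ℕ, Measure (Fin n) → LinearMap.BilinForm ℝ (Fin n → ℝ),
    (∀ n μ g h, B n μ g h = B n μ h g) ∧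
    ∀ (E : Type u) [NormedAddCommGroup E] [NormedSpace ℝ E] [CompleteSpace E]
      (M : Type u) [TopologicalSpace M] [T3Space M] [ChartedSpace E M] [IsManifold 𝓘(ℝ, E) ∞ M]
      (n : ℕ) (S : FiniteStatisticalModel k E M n) (x : M) (V W : TangentSpace 𝓘(ℝ, E) x),
      F E M n S x V W
        = B n (S.p x) (S.toStatisticalModel.dlog x V) (S.toStatisticalModel.dlog x W)

/-- `F` is weakly continuous: `x ↦ F(V, W)_x` is continuous for all continuous `V`, `W`. -/
def IsWeaklyContinuous (F : FiniteField.{u} k) : Prop :=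
  ∀ (E : Type u) [NormedAddCommGroup E] [NormedSpace ℝ E] [CompleteSpace E]
    (M : Type u) [TopologicalSpace M] [T3Space M] [ChartedSpace E M] [IsManifold 𝓘(ℝ, E) ∞ M]
    (n : ℕ) (S : FiniteStatisticalModel k E M n) (V W : (x : M) → TangentSpace 𝓘(ℝ, E) x),
    IsContVectorField V → IsContVectorField W →
      Continuous (fun x => F E M n S x (V x) (W x))

/-- `F` does not increase under the restricted Markov morphisms `(f, T_*)` such that `f` is a
diffeomorphism and `T` satisfies the condition `R` with respect to the reference measure of the
target model. -/
def IsMonotoneFor (R : ∀ {n m : ℕ}, Kernel (Fin n) (Fin m) → Measure (Fin m) → Prop)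
    (F : FiniteField.{u} k) : Prop :=
  ∀ (E : Type u) [NormedAddCommGroup E] [NormedSpace ℝ E] [CompleteSpace E]
    (M : Type u) [TopologicalSpace M] [T3Space M] [ChartedSpace E M] [IsManifold 𝓘(ℝ, E) ∞ M]
    (n m : ℕ) (S₁ : FiniteStatisticalModel k E M n) (S₂ : FiniteStatisticalModel k E M m)
    (f : M ≃ₘ^1⟮𝓘(ℝ, E), 𝓘(ℝ, E)⟯ M) (T : Kernel (Fin n) (Fin m)) [IsMarkovKernel T],
    IsRestrictedMarkovMorphism S₁.toStatisticalModel S₂.toStatisticalModel f T → R T S₂.μ →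
    ∀ (x : M) (V : TangentSpace 𝓘(ℝ, E) x),
      F E M m S₂ (f x) (mfderiv 𝓘(ℝ, E) 𝓘(ℝ, E) f x V) (mfderiv 𝓘(ℝ, E) 𝓘(ℝ, E) f x V)
        ≤ F E M n S₁ x V V

/-- Monotonicity under all representable restricted Markov morphisms. -/
def IsMonotone (F : FiniteField.{u} k) : Prop :=
  IsMonotoneFor (fun T μ' => IsRepresentable T μ') F

/-- Monotonicity under the restricted Markov morphisms representable by a strictly positive
Markov transition kernel. -/
def IsMonotonePositive (F : FiniteField.{u} k) : Prop :=
  IsMonotoneFor (fun T μ' => IsPositivelyRepresentable T μ') F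

end FiniteField

end InfoGeo

end

/-! Monotonicity. Let s₁ and s₂ be the scores (logarithmic derivatives) of the two models at x and
f(x) in the directions V and df V. For bounded measurable φ, the expectation of φ under p₂(f(x)) is
the expectation of Tφ under p₁(x). Differentiating along a curve gives E₂[φ s₂] = E₁[(Tφ) s₁], so s₂
is the image of s₁ under the predual of T. Testing with truncations φ of s₂ and using φ s₁ ≤ (φ² +
s₁²)/2 yields E₂[s₂²] ≤ E₁[s₁²], even when the second moments may be infinite
(`lintegral_sq_le_of_dual`, `StatisticalModel.efisher_le`).

The analytic core is differentiation under the integral sign (`hasDerivAt_integral_p`). No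
integrable majorant is available; continuity of the L^k norms of the score replaces it. It controls
the L¹ norm of the score along the curve, hence the L¹ norm of the difference quotients of the
density, and a Pratt-type theorem (`tendsto_integral_of_limsup_bound_le`) then passes to the limit.

Uniqueness. A local form field becomes a family of quadratic forms on sum-zero vectors over the open
simplices, by dividing a vector u by the distribution ν (`FiniteField.isMonotoneFamily`). The
exponential family of all positive distributions supplies the models that transfer continuity and
monotonicity to the simplices. There Chentsov's argument applies
(`IsMonotoneFamily.exists_eq_fisher`): splitting atoms has a Markov left inverse, so the form is
invariant under splitting; at uniform distributions symmetry leaves one constant C(n); splitting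
into equal atoms determines the form at rational distributions and makes C(n)/n constant; continuity
does the rest. -/

namespace InfoGeo

open Filter Topology

/-! ### Calculus and integration. -/

/-- A function whose line derivatives depend continuously on the point and the direction can be
differentiated along every curve that is differentiable at the point in question. -/
theorem hasDerivAt_comp_of_hasLineDerivAt {E : Type*} [NormedAddCommGroup E] [NormedSpace ℝ E]
    {G : E → ℝ} {D : E → E → ℝ} {U : Set E} {c : ℝ → E} {t : ℝ} {v : E}
    (hU : U ∈ 𝓝 (c t)) (hG : ∀ y ∈ U, ∀ w, HasLineDerivAt ℝ G (D y w) y w)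
    (hD : ContinuousAt (Function.uncurry D) (c t, v)) (hc : HasDerivAt c v t) :
    HasDerivAt (G ∘ c) (D (c t) v) t := by
  rw [hasDerivAt_iff_isLittleO_nhds_zero, Asymptotics.isLittleO_iff]
  intro ε hε
  have hD' : ∀ᶠ z in 𝓝 (c t) ×ˢ 𝓝 v, z.1 ∈ U ∧ ‖D z.1 z.2 - D (c t) v‖ ≤ ε := by
    have h1 := Metric.tendsto_nhds.1 hD ε hε
    rw [nhds_prod_eq] at h1
    filter_upwards [h1, (tendsto_fst (g := 𝓝 v)).eventually hU] with z hz hz'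
    exact ⟨hz', (by simpa [Function.uncurry, dist_eq_norm] using hz.le)⟩
  rw [← nhds_prod_eq] at hD'
  obtain ⟨r, hr, hrU⟩ := Metric.mem_nhds_iff.1 hD'
  -- The curve is replaced by its chord from c t to c (t + h), whose direction is w h rather than v.
  -- Only line derivatives of G are needed on the chord, and joint continuity of D absorbs the error
  -- w h - v. The mean value inequality then gives the bound.
  set w : ℝ → E := fun h => h⁻¹ • (c (t + h) - c t) with hw
  have hwt : Tendsto w (𝓝[≠] 0) (𝓝 v) := hc.tendsto_slope_zero
  have h1 : ∀ᶠ h in 𝓝[≠] (0 : ℝ), ‖w h - v‖ < r := by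
    have := Metric.tendsto_nhds.1 hwt r hr
    simpa [dist_eq_norm] using this
  have h2 : ∀ᶠ h in 𝓝[≠] (0 : ℝ), ‖h • w h‖ < r := by
    have h3 : Tendsto (fun h : ℝ => h • w h) (𝓝[≠] 0) (𝓝 ((0 : ℝ) • v)) :=
      (tendsto_id.mono_left nhdsWithin_le_nhds).smul hwt
    rw [zero_smul] at h3
    have := Metric.tendsto_nhds.1 h3 r hr
    simpa [dist_eq_norm] using this
  have key : ∀ᶠ h in 𝓝[≠] (0 : ℝ),
      ‖(G ∘ c) (t + h) - (G ∘ c) t - h • D (c t) v‖ ≤ ε * ‖h‖ := by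
    filter_upwards [h1, h2, self_mem_nhdsWithin] with h hh1 hh2 hh0
    have hh0' : h ≠ 0 := hh0
    have hmem : ∀ s ∈ segment ℝ (0 : ℝ) h,
        c t + s • w h ∈ U ∧ ‖D (c t + s • w h) (w h) - D (c t) v‖ ≤ ε := by
      intro s hs
      refine hrU (a := (c t + s • w h, w h)) ?_
      have hsh : ‖s‖ ≤ ‖h‖ := by
        obtain ⟨a, b, ha, hb, hab, rfl⟩ := hs
        rw [smul_zero, zero_add, norm_smul, Real.norm_of_nonneg hb]
        nlinarith [norm_nonneg h]
      rw [Metric.mem_ball, Prod.dist_eq, max_lt_iff]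
      constructor
      · rw [dist_eq_norm, add_sub_cancel_left]
        refine lt_of_le_of_lt ?_ hh2
        rw [norm_smul s, norm_smul h]
        exact mul_le_mul_of_nonneg_right hsh (norm_nonneg (w h))
      · rwa [dist_eq_norm]
    have hder : ∀ s ∈ segment ℝ (0 : ℝ) h,
        HasDerivWithinAt (fun s : ℝ => G (c t + s • w h) - s * D (c t) v)
          (D (c t + s • w h) (w h) - D (c t) v) (segment ℝ (0 : ℝ) h) s := by
      intro s hs
      have h4 := hG _ (hmem s hs).1 (w h)
      have h5 : HasDerivAt (fun r : ℝ => G (c t + r • w h)) (D (c t + s • w h) (w h)) s := by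
        have h6 : HasDerivAt (fun r : ℝ => r - s) 1 s := (hasDerivAt_id s).sub_const s
        have h4' : HasDerivAt (fun t_1 : ℝ => G (c t + s • w h + t_1 • w h))
          (D (c t + s • w h) (w h)) (s - s) := by rw [sub_self]; exact h4
        have h7 := HasDerivAt.comp (h := fun r : ℝ => r - s) s h4' h6
        rw [mul_one] at h7
        refine h7.congr_of_eventuallyEq (Eventually.of_forall fun r => ?_)
        simp only [Function.comp]
        congr 1
        module
      have h8 : HasDerivAt (fun s : ℝ => s * D (c t) v) (D (c t) v) s := by
        simpa using (hasDerivAt_id s).mul_const (D (c t) v)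
      exact (h5.sub h8).hasDerivWithinAt
    have h9 := Convex.norm_image_sub_le_of_norm_hasDerivWithin_le hder
      (fun s hs => (hmem s hs).2) (convex_segment 0 h) (left_mem_segment ℝ 0 h)
      (right_mem_segment ℝ 0 h)
    have h10 : c t + h • w h = c (t + h) := by
      simp only [hw, smul_smul, mul_inv_cancel₀ hh0', one_smul]
      abel
    simp only [h10, zero_smul, add_zero, zero_mul, sub_zero] at h9
    simp only [Function.comp, smul_eq_mul]
    rwa [sub_right_comm] at h9
  rw [eventually_nhdsWithin_iff] at key
  filter_upwards [key] with h hh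
  by_cases h0 : h = 0
  · simp [h0]
  · exact hh h0

/-- A weak form of Pratt's extension of the dominated convergence theorem. -/
theorem tendsto_integral_of_limsup_bound_le {α : Type*} [MeasurableSpace α] {μ : Measure α}
    {f g : ℕ → α → ℝ} {F G : α → ℝ}
    (hf : ∀ n, Integrable (f n) μ) (hF : Integrable F μ)
    (hg : ∀ n, Integrable (g n) μ) (hG : Integrable G μ)
    (hfg : ∀ n, ∀ᵐ a ∂μ, |f n a| ≤ g n a)
    (hlim : ∀ᵐ a ∂μ, Tendsto (fun n => f n a) atTop (𝓝 (F a)))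
    (hlim' : ∀ᵐ a ∂μ, Tendsto (fun n => g n a) atTop (𝓝 (G a)))
    (hint : ∀ ε > 0, ∀ᶠ n in atTop, ∫ a, g n a ∂μ ≤ ∫ a, G a ∂μ + ε) :
    Tendsto (fun n => ∫ a, f n a ∂μ) atTop (𝓝 (∫ a, F a ∂μ)) := by
  -- Fatou for g + f ≥ 0 together with the upper bound on ∫ g bounds ∫ f below. The upper bound is
  -- the same statement for -f.
  have half : ∀ {f : ℕ → α → ℝ} {F : α → ℝ}, (∀ n, Integrable (f n) μ) → Integrable F μ →
      (∀ n, ∀ᵐ a ∂μ, |f n a| ≤ g n a) →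
      (∀ᵐ a ∂μ, Tendsto (fun n => f n a) atTop (𝓝 (F a))) →
      ∀ ε > 0, ∀ᶠ n in atTop, ∫ a, F a ∂μ - ε ≤ ∫ a, f n a ∂μ := by
    intro f F hf hF hfg hlim ε hε
    have h0 : ∀ n, 0 ≤ᵐ[μ] fun a => g n a + f n a := fun n => by
      filter_upwards [hfg n] with a ha
      have := neg_abs_le (f n a)
      simp only [Pi.zero_apply]; linarith
    have h0' : 0 ≤ᵐ[μ] fun a => G a + F a := by
      filter_upwards [hlim, hlim', ae_all_iff.2 h0] with a h1 h2 h3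
      exact ge_of_tendsto' (h2.add h1) h3
    have hfatou : ENNReal.ofReal (∫ a, (G a + F a) ∂μ) ≤
        liminf (fun n => ENNReal.ofReal (∫ a, (g n a + f n a) ∂μ)) atTop := by
      have h2 : ENNReal.ofReal (∫ a, (G a + F a) ∂μ) = ∫⁻ a, ENNReal.ofReal (G a + F a) ∂μ :=
        ofReal_integral_eq_lintegral_ofReal (hG.add hF) h0'
      have h1 : ∀ n, ENNReal.ofReal (∫ a, (g n a + f n a) ∂μ)
          = ∫⁻ a, ENNReal.ofReal (g n a + f n a) ∂μ := fun n =>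
        ofReal_integral_eq_lintegral_ofReal ((hg n).add (hf n)) (h0 n)
      simp_rw [h1]
      rw [h2]
      refine le_trans (lintegral_mono_ae ?_) (lintegral_liminf_le' fun n =>
        ((hg n).add (hf n)).aestronglyMeasurable.aemeasurable.ennreal_ofReal)
      filter_upwards [hlim, hlim'] with a h1 h2
      exact (((ENNReal.continuous_ofReal.tendsto _).comp (h2.add h1)).liminf_eq).ge
    have h2 : ∀ᶠ n in atTop, ∫ a, (G a + F a) ∂μ - ε / 2 ≤ ∫ a, (g n a + f n a) ∂μ := by
      rcases le_or_gt (∫ a, (G a + F a) ∂μ - ε / 2) 0 with hle | hlt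
      · exact Eventually.of_forall fun n => hle.trans (integral_nonneg_of_ae (h0 n))
      · have h3 : ENNReal.ofReal (∫ a, (G a + F a) ∂μ - ε / 2)
            < liminf (fun n => ENNReal.ofReal (∫ a, (g n a + f n a) ∂μ)) atTop :=
          lt_of_lt_of_le ((ENNReal.ofReal_lt_ofReal_iff (by linarith)).2 (by linarith)) hfatou
        filter_upwards [eventually_lt_of_lt_liminf h3] with n hn
        exact (ENNReal.ofReal_lt_ofReal_iff_of_nonneg hlt.le).1 hn |>.le
    filter_upwards [h2, hint (ε / 2) (by linarith)] with n h3 h4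
    rw [integral_add hG hF, integral_add (hg n) (hf n)] at h3
    linarith
  rw [Metric.tendsto_nhds]
  intro ε hε
  have hneg := half (f := fun n a => - f n a) (F := fun a => - F a) (fun n => (hf n).neg) hF.neg
    (fun n => by simpa using hfg n) (by filter_upwards [hlim] with a ha using ha.neg)
    (ε / 2) (by linarith)
  filter_upwards [half hf hF hfg hlim (ε / 2) (by linarith), hneg] with n h1 h2
  simp only [integral_neg] at h2
  rw [Real.dist_eq, abs_lt]
  constructor <;> linarith

/-- Riemann sums of the absolute value of a continuous derivative bound the increment. -/
theorem enorm_sub_le_liminf_riemann {g g' : ℝ → ℝ}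
    (hg : ∀ s ∈ Set.Icc (0 : ℝ) 1, HasDerivAt g (g' s) s)
    (hc : ContinuousOn g' (Set.Icc 0 1)) :
    ‖g 1 - g 0‖ₑ ≤ liminf (fun n : ℕ => ((n + 1 : ℕ) : ENNReal)⁻¹ *
      ∑ i ∈ Finset.range (n + 1), ‖g' (i / ((n + 1 : ℕ) : ℝ))‖ₑ) atTop := by
  have huc := (isCompact_Icc (a := (0 : ℝ)) (b := 1)).uniformContinuousOn_of_continuous hc
  refine ENNReal.le_of_forall_pos_le_add fun ε hε hfin => ?_
  have hε' : (0 : ℝ) < ε := hε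
  obtain ⟨δ, hδ, hδ'⟩ := Metric.uniformContinuousOn_iff.1 huc ε hε'
  have hev : ∀ᶠ n : ℕ in atTop, ‖g 1 - g 0‖ₑ ≤ (((n + 1 : ℕ) : ENNReal)⁻¹ *
      ∑ i ∈ Finset.range (n + 1), ‖g' (i / ((n + 1 : ℕ) : ℝ))‖ₑ) + ε := by
    obtain ⟨N, hN⟩ := exists_nat_one_div_lt hδ
    filter_upwards [eventually_ge_atTop N] with n hn
    set m : ℝ := ((n + 1 : ℕ) : ℝ) with hm
    have hm0 : 0 < m := by positivity
    have hinv : m⁻¹ < δ := by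
      refine lt_of_le_of_lt ?_ hN
      rw [one_div]
      apply inv_anti₀ (by positivity)
      rw [hm]; push_cast
      have : (N : ℝ) ≤ n := by exact_mod_cast hn
      linarith
    have hstep : ∀ i ∈ Finset.range (n + 1),
        |g ((i + 1 : ℕ) / m) - g (i / m)| ≤ (|g' (i / m)| + ε) * m⁻¹ := by
      intro i hi
      have hi' : (i : ℝ) + 1 ≤ m := by
        rw [hm]; exact_mod_cast Finset.mem_range.1 hi
      have hsub : Set.Icc ((i : ℝ) / m) ((i + 1 : ℕ) / m) ⊆ Set.Icc 0 1 := by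
        apply Set.Icc_subset_Icc
        · positivity
        · rw [div_le_one hm0]; push_cast; exact hi'
      have hle : (i : ℝ) / m ≤ (i + 1 : ℕ) / m := by
        push_cast; gcongr; linarith
      have hb : ∀ s ∈ Set.Icc ((i : ℝ) / m) ((i + 1 : ℕ) / m), ‖g' s‖ ≤ |g' (i / m)| + ε := by
        intro s hs
        have h1 := hδ' s (hsub hs) (i / m) (hsub (Set.left_mem_Icc.2 hle)) (by
          rw [Real.dist_eq, abs_of_nonneg (by linarith [hs.1])]
          have := hs.2
          have h2 : ((i + 1 : ℕ) : ℝ) / m = i / m + m⁻¹ := by push_cast; ring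
          linarith)
        rw [Real.dist_eq] at h1
        rw [Real.norm_eq_abs]
        have := abs_sub_abs_le_abs_sub (g' s) (g' (i / m))
        linarith
      have h3 := Convex.norm_image_sub_le_of_norm_hasDerivWithin_le
        (fun s hs => (hg s (hsub hs)).hasDerivWithinAt) hb (convex_Icc _ _)
        (Set.left_mem_Icc.2 hle) (Set.right_mem_Icc.2 hle)
      have h4 : ‖((i + 1 : ℕ) : ℝ) / m - i / m‖ = m⁻¹ := by
        have : ((i + 1 : ℕ) : ℝ) / m - i / m = m⁻¹ := by push_cast; ring
        rw [this, Real.norm_of_nonneg (by positivity)]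
      rw [h4] at h3
      exact h3
    have hsum : g 1 - g 0 = ∑ i ∈ Finset.range (n + 1), (g ((i + 1 : ℕ) / m) - g (i / m)) := by
      rw [Finset.sum_range_sub (fun i : ℕ => g (i / m))]
      simp [hm]
      rw [div_self]; positivity
    have hreal : |g 1 - g 0| ≤ m⁻¹ * ∑ i ∈ Finset.range (n + 1), |g' (i / m)| + ε := by
      rw [hsum]
      refine (Finset.abs_sum_le_sum_abs _ _).trans ((Finset.sum_le_sum hstep).trans ?_)
      rw [← Finset.sum_mul, Finset.sum_add_distrib, Finset.sum_const, Finset.card_range,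
        nsmul_eq_mul, ← hm, add_mul, mul_comm m, mul_assoc, mul_inv_cancel₀ hm0.ne', mul_one,
        mul_comm]
    rw [← ofReal_norm, Real.norm_eq_abs]
    refine (ENNReal.ofReal_le_ofReal hreal).trans ?_
    rw [ENNReal.ofReal_add (by positivity) (by positivity), ENNReal.ofReal_mul (by positivity),
      ENNReal.ofReal_inv_of_pos hm0, ENNReal.ofReal_sum_of_nonneg (fun _ _ => abs_nonneg _)]
    simp only [← Real.norm_eq_abs, ofReal_norm, ENNReal.ofReal_coe_nnreal, hm,
      ENNReal.ofReal_natCast]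
    exact le_rfl
  rw [← liminf_add_const _ _ _ (by isBoundedDefault) (by isBoundedDefault)]
  exact le_liminf_of_le (by isBoundedDefault) hev

/-- Fatou applied to Riemann sums takes the place of Tonelli: each sum involves finitely many slices
`g' s`, so no joint measurability in (s, a) is required. -/
theorem lintegral_enorm_sub_le_of_hasDerivAt {α : Type*} [MeasurableSpace α] {μ : Measure α}
    {g g' : ℝ → α → ℝ} {C : ENNReal}
    (hg : ∀ᵐ a ∂μ, (∀ s ∈ Set.Icc (0 : ℝ) 1, HasDerivAt (fun s => g s a) (g' s a) s) ∧
      ContinuousOn (fun s => g' s a) (Set.Icc 0 1))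
    (hm : ∀ s ∈ Set.Icc (0 : ℝ) 1, AEMeasurable (g' s) μ)
    (hC : ∀ s ∈ Set.Icc (0 : ℝ) 1, ∫⁻ a, ‖g' s a‖ₑ ∂μ ≤ C) :
    ∫⁻ a, ‖g 1 a - g 0 a‖ₑ ∂μ ≤ C := by
  have hmem : ∀ n : ℕ, ∀ i ∈ Finset.range (n + 1), (i : ℝ) / ((n + 1 : ℕ) : ℝ) ∈
      Set.Icc (0 : ℝ) 1 := by
    intro n i hi
    refine ⟨by positivity, ?_⟩
    rw [div_le_one (by positivity)]
    exact_mod_cast (Finset.mem_range.1 hi).le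
  obtain ⟨F, hF⟩ : ∃ F : ℕ → α → ENNReal, ∀ n a, F n a = ((n + 1 : ℕ) : ENNReal)⁻¹ *
      ∑ i ∈ Finset.range (n + 1), ‖g' (i / ((n + 1 : ℕ) : ℝ)) a‖ₑ := ⟨_, fun _ _ => rfl⟩
  have hmeas : ∀ n, AEMeasurable (F n) μ := fun n => by
    rw [funext (hF n)]
    exact (Finset.aemeasurable_fun_sum _ fun i hi => (hm _ (hmem n i hi)).enorm).const_mul _
  calc ∫⁻ a, ‖g 1 a - g 0 a‖ₑ ∂μ
      ≤ ∫⁻ a, liminf (fun n => F n a) atTop ∂μ := by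
        refine lintegral_mono_ae ?_
        filter_upwards [hg] with a ha
        simp_rw [hF]
        exact enorm_sub_le_liminf_riemann (g := fun s => g s a) (g' := fun s => g' s a) ha.1 ha.2
    _ ≤ liminf (fun n => ∫⁻ a, F n a ∂μ) atTop := lintegral_liminf_le' hmeas
    _ ≤ C := by
        refine liminf_le_of_le (by isBoundedDefault) fun b hb => ?_
        obtain ⟨n, hn⟩ := hb.exists
        refine hn.trans ?_
        simp_rw [hF]
        rw [lintegral_const_mul' _ _ (by simp), lintegral_finsetSum' _ fun i hi =>
          (hm _ (hmem n i hi)).enorm]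
        calc _ ≤ ((n + 1 : ℕ) : ENNReal)⁻¹ * ∑ i ∈ Finset.range (n + 1), C := by
              gcongr with i hi
              exact hC _ (hmem n i hi)
          _ = C := by
              rw [Finset.sum_const, Finset.card_range, nsmul_eq_mul, ← mul_assoc,
                ENNReal.inv_mul_cancel (by simp) (by simp), one_mul]

/-- If `s₂` is the image of `s₁` under the predual of a Markov operator, then its second moment
is at most that of `s₁`. -/
theorem lintegral_sq_le_of_dual {Ω Ω' : Type*} [MeasurableSpace Ω] [MeasurableSpace Ω']
    {P : Measure Ω} [IsProbabilityMeasure P] {T : Kernel Ω Ω'} [IsMarkovKernel T]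
    {s₁ : Ω → ℝ} {s₂ : Ω' → ℝ} (h₁ : Integrable s₁ P) (h₂ : Integrable s₂ (P.bind T))
    (hdual : ∀ φ : Ω' → ℝ, Measurable φ → (∃ C, ∀ w, |φ w| ≤ C) →
      ∫ w, φ w * s₂ w ∂(P.bind T) = ∫ w, (∫ w', φ w' ∂(T w)) * s₁ w ∂P) :
    ∫⁻ w, ENNReal.ofReal (s₂ w ^ 2) ∂(P.bind T) ≤ ∫⁻ w, ENNReal.ofReal (s₁ w ^ 2) ∂P := by
  have : IsProbabilityMeasure (P.bind T) := by
    infer_instance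
  by_cases htop : ∫⁻ w, ENNReal.ofReal (s₁ w ^ 2) ∂P = ⊤
  · rw [htop]; exact le_top
  have hsq : Integrable (fun w => s₁ w ^ 2) P := by
    refine ⟨h₁.aestronglyMeasurable.pow 2, ?_⟩
    rw [hasFiniteIntegral_iff_ofReal (Eventually.of_forall fun w => sq_nonneg _)]
    exact lt_top_iff_ne_top.2 htop
  set σ := h₂.aestronglyMeasurable.mk s₂ with hσ
  have hσm : Measurable σ := h₂.aestronglyMeasurable.stronglyMeasurable_mk.measurable
  have hσe : s₂ =ᵐ[P.bind T] σ := h₂.aestronglyMeasurable.ae_eq_mk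
  -- Truncating a measurable version of s₂ gives bounded test functions, admissible in `hdual`, with
  -- φ s₂ = φ² almost everywhere.
  set φ : ℕ → Ω' → ℝ := fun n => {w | |σ w| ≤ n}.indicator σ with hφ
  have hφm : ∀ n, Measurable (φ n) := fun n =>
    hσm.indicator (measurableSet_le hσm.abs measurable_const)
  have hφb : ∀ n w, |φ n w| ≤ n := by
    intro n w
    simp only [hφ, Set.indicator_apply, Set.mem_ofPred_eq]
    split_ifs with h
    · exact h
    · simp
  have hφi : ∀ n (Q : Measure Ω') [IsProbabilityMeasure Q], Integrable (φ n) Q := fun n Q _ =>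
    Integrable.of_bound (hφm n).aestronglyMeasurable n (Eventually.of_forall (hφb n))
  have hφsqb : ∀ n w, |φ n w ^ 2| ≤ (n : ℝ) ^ 2 := fun n w => by
    rw [abs_pow]; exact pow_le_pow_left₀ (abs_nonneg _) (hφb n w) 2
  have hφsq : ∀ n (Q : Measure Ω') [IsProbabilityMeasure Q], Integrable (fun w => φ n w ^ 2) Q :=
    fun n Q _ => Integrable.of_bound ((hφm n).pow_const 2).aestronglyMeasurable ((n : ℝ) ^ 2)
      (Eventually.of_forall (hφsqb n))
  have hbind : ∀ ψ : Ω' → ℝ, Integrable ψ (P.bind T) →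
      ∫ w, ψ w ∂(P.bind T) = ∫ w, ∫ w', ψ w' ∂(T w) ∂P := fun ψ hψ =>
    Kernel.integral_comp (κ := Kernel.const Unit P) (η := T) (a := ()) hψ
  have hbound : ∀ n, ∫ w, φ n w ^ 2 ∂(P.bind T) ≤ ∫ w, s₁ w ^ 2 ∂P := by
    intro n
    have e1 : ∫ w, φ n w ^ 2 ∂(P.bind T) = ∫ w, φ n w * s₂ w ∂(P.bind T) := by
      refine integral_congr_ae ?_
      filter_upwards [hσe] with w hw
      simp only [hφ, Set.indicator_apply, hw]
      split_ifs <;> ring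
    have hTm : StronglyMeasurable fun w => ∫ w', φ n w' ∂(T w) :=
      (hφm n).stronglyMeasurable.integral_kernel
    have hTm2 : StronglyMeasurable fun w => ∫ w', φ n w' ^ 2 ∂(T w) :=
      ((hφm n).pow_const 2).stronglyMeasurable.integral_kernel
    have hTb : ∀ w, ‖∫ w', φ n w' ∂(T w)‖ ≤ n := fun w => by
      simpa using norm_integral_le_of_norm_le_const (μ := T w) (Eventually.of_forall fun w => (show ‖φ n w‖ ≤ n from hφb n w))
    have hTb2 : ∀ w, ‖∫ w', φ n w' ^ 2 ∂(T w)‖ ≤ (n : ℝ) ^ 2 := fun w => by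
      simpa using norm_integral_le_of_norm_le_const (μ := T w) 
        (Eventually.of_forall fun w => (show ‖φ n w ^ 2‖ ≤ (n : ℝ) ^ 2 from hφsqb n w))
    have hT2i : Integrable (fun w => ∫ w', φ n w' ^ 2 ∂(T w)) P :=
      Integrable.of_bound hTm2.aestronglyMeasurable _ (Eventually.of_forall hTb2)
    -- From φ s₁ ≤ (φ² + s₁²)/2, integrated over T w and then over P. By duality the left side is ∫
    -- φ², so half of it can be absorbed; this is legitimate because ∫ φ² is finite.
    have e2 : ∫ w, (∫ w', φ n w' ∂(T w)) * s₁ w ∂P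
        ≤ ∫ w, ((∫ w', φ n w' ^ 2 ∂(T w)) / 2 + s₁ w ^ 2 / 2) ∂P := by
      refine integral_mono (h₁.bdd_mul hTm.aestronglyMeasurable (Eventually.of_forall hTb))
        ((hT2i.div_const 2).add (hsq.div_const 2)) fun w => ?_
      simp only
      have : ∫ w', φ n w' * s₁ w ∂(T w) ≤ ∫ w', (φ n w' ^ 2 / 2 + s₁ w ^ 2 / 2) ∂(T w) := by
        refine integral_mono ((hφi n _).mul_const _)
          (((hφsq n _).div_const 2).add (integrable_const _)) fun w' => ?_
        simp only
        nlinarith [sq_nonneg (φ n w' - s₁ w)]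
      rw [integral_mul_const, integral_add ((hφsq n _).div_const 2) (integrable_const _),
        integral_div, integral_const] at this
      simpa using this
    rw [integral_add (hT2i.div_const 2) (hsq.div_const 2), integral_div, integral_div,
      ← hbind _ (hφsq n _), ← hdual _ (hφm n) ⟨n, hφb n⟩, ← e1] at e2
    linarith
  have hlim : ∀ᵐ w ∂(P.bind T), Tendsto (fun n => ENNReal.ofReal (φ n w ^ 2)) atTop
      (𝓝 (ENNReal.ofReal (s₂ w ^ 2))) := by
    filter_upwards [hσe] with w hw
    obtain ⟨N, hN⟩ := exists_nat_ge |σ w|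
    refine tendsto_const_nhds.congr' ?_
    filter_upwards [eventually_ge_atTop N] with n hn
    have : |σ w| ≤ n := hN.trans (by exact_mod_cast hn)
    simp [hφ, this, hw]
  calc ∫⁻ w, ENNReal.ofReal (s₂ w ^ 2) ∂(P.bind T)
      = ∫⁻ w, liminf (fun n => ENNReal.ofReal (φ n w ^ 2)) atTop ∂(P.bind T) :=
        lintegral_congr_ae (by filter_upwards [hlim] with w hw using hw.liminf_eq.symm)
    _ ≤ liminf (fun n => ∫⁻ w, ENNReal.ofReal (φ n w ^ 2) ∂(P.bind T)) atTop :=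
        lintegral_liminf_le fun n => ((hφm n).pow_const 2).ennreal_ofReal
    _ ≤ ∫⁻ w, ENNReal.ofReal (s₁ w ^ 2) ∂P := by
        refine liminf_le_of_le (by isBoundedDefault) fun b hb => ?_
        obtain ⟨n, hn⟩ := hb.exists
        refine hn.trans ?_
        rw [← ofReal_integral_eq_lintegral_ofReal (hφsq n _)
          (Eventually.of_forall fun w => sq_nonneg _), ← ofReal_integral_eq_lintegral_ofReal hsq
          (Eventually.of_forall fun w => sq_nonneg _)]
        exact ENNReal.ofReal_le_ofReal (hbound n)

/-! ### Curves and vector fields on Banach manifolds. -/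

section Geometry

variable {E : Type*} [NormedAddCommGroup E] [NormedSpace ℝ E]
  {M : Type*} [TopologicalSpace M] [ChartedSpace E M] [IsManifold 𝓘(ℝ, E) ∞ M]

theorem continuous_tangentBundle_mk :
    Continuous (fun z : E × E => (⟨z.1, z.2⟩ : TangentBundle 𝓘(ℝ, E) E)) :=
  (tangentBundleModelSpaceHomeomorph 𝓘(ℝ, E)).symm.continuous

theorem continuousOn_mfderiv_symm {e : OpenPartialHomeomorph M E}
    (he : e ∈ IsManifold.maximalAtlas 𝓘(ℝ, E) ∞ M) :
    ContinuousOn (fun z : E × E =>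
      (⟨e.symm z.1, mfderiv 𝓘(ℝ, E) 𝓘(ℝ, E) e.symm z.1 z.2⟩ : TangentBundle 𝓘(ℝ, E) M))
      (e.target ×ˢ Set.univ) := by
  have h1 := (contMDiffOn_symm_of_mem_maximalAtlas he).continuousOn_tangentMapWithin
    (by norm_cast) e.open_target.uniqueMDiffOn
  refine (h1.comp continuous_tangentBundle_mk.continuousOn fun z hz => hz.1).congr fun z hz => ?_
  simp only [Function.comp, tangentMapWithin]
  rw [mfderivWithin_of_isOpen e.open_target hz.1]

/-- The chain rule for continuously Gâteaux-differentiable functions along curves. -/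
theorem IsContGateauxDiff.hasDerivAt_comp {F : M → ℝ} (hF : IsContGateauxDiff (E := E) F)
    {γ : ℝ → M} {t : ℝ} {L : ℝ →L[ℝ] TangentSpace 𝓘(ℝ, E) (γ t)}
    (hγ : HasMFDerivAt 𝓘(ℝ, ℝ) 𝓘(ℝ, E) γ t L) :
    HasDerivAt (F ∘ γ) (gateauxDeriv F (γ t) (L 1)) t := by
  set e := chartAt E (γ t) with he_def
  have he : e ∈ IsManifold.maximalAtlas 𝓘(ℝ, E) ∞ M := IsManifold.chart_mem_maximalAtlas _
  have hed : e.MDifferentiable 𝓘(ℝ, E) 𝓘(ℝ, E) := mdifferentiable_chart (γ t)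
  have hx : γ t ∈ e.source := mem_chart_source E _
  -- The Gâteaux derivative read in the chart. Continuity on the tangent bundle becomes joint
  -- continuity of D in point and direction, as the chain rule for curves in E demands.
  set D : E → E → ℝ := fun y w =>
    gateauxDeriv F (e.symm y) (mfderiv 𝓘(ℝ, E) 𝓘(ℝ, E) e.symm y w) with hD
  have hcv : HasDerivAt (e ∘ γ) (mfderiv 𝓘(ℝ, E) 𝓘(ℝ, E) e (γ t) (L 1)) t := by
    obtain ⟨A, hA, hA1⟩ : ∃ A : ℝ →L[ℝ] E, HasFDerivAt (e ∘ γ) A t ∧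
        A 1 = mfderiv 𝓘(ℝ, E) 𝓘(ℝ, E) e (γ t) (L 1) :=
      ⟨_, ((hed.mdifferentiableAt hx).hasMFDerivAt.comp t hγ).hasFDerivAt, rfl⟩
    rw [← hA1]
    exact hA.hasDerivAt
  have hline : ∀ y ∈ e.target, ∀ w, HasLineDerivAt ℝ (F ∘ e.symm) (D y w) y w := by
    intro y hy w
    have h := hF.hasLineDerivAt e he (e.symm y) (e.map_target hy)
      (mfderiv 𝓘(ℝ, E) 𝓘(ℝ, E) e.symm y w)
    have h2 : mfderiv 𝓘(ℝ, E) 𝓘(ℝ, E) e (e.symm y) (mfderiv 𝓘(ℝ, E) 𝓘(ℝ, E) e.symm y w) = w :=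
      congrArg (fun A : E →L[ℝ] E => A w) (hed.comp_symm_deriv hy)
    rw [h2, e.right_inv hy] at h
    exact h
  have hcont : ContinuousAt (Function.uncurry D)
      ((e ∘ γ) t, mfderiv 𝓘(ℝ, E) 𝓘(ℝ, E) e (γ t) (L 1)) := by
    have h := hF.continuous_deriv.comp_continuousOn (continuousOn_mfderiv_symm he)
    exact h.continuousAt ((e.open_target.prod isOpen_univ).mem_nhds ⟨e.map_source hx, trivial⟩)
  have key := hasDerivAt_comp_of_hasLineDerivAt
    (e.open_target.mem_nhds (e.map_source hx)) hline hcont hcv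
  have h1 : D ((e ∘ γ) t) (mfderiv 𝓘(ℝ, E) 𝓘(ℝ, E) e (γ t) (L 1)) = gateauxDeriv F (γ t) (L 1) := by
    have h2 : mfderiv 𝓘(ℝ, E) 𝓘(ℝ, E) e.symm (e (γ t)) (mfderiv 𝓘(ℝ, E) 𝓘(ℝ, E) e (γ t) (L 1))
        = L 1 := congrArg (fun A : E →L[ℝ] E => A (L 1)) (hed.symm_comp_deriv hx)
    simp only [hD, Function.comp]
    rw [h2]
    exact congrArg (fun y : M => gateauxDeriv F y (show E from L 1)) (e.left_inv hx)
  rw [h1] at key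
  refine key.congr_of_eventuallyEq ?_
  have hγc : ContinuousAt γ t := hγ.continuousAt
  filter_upwards [hγc (e.open_source.mem_nhds hx)] with s hs
  simp [Function.comp, e.left_inv hs]

/-- Every tangent vector is the value of a continuous vector field, which has a local integral
curve through the point in question. -/
theorem exists_isContVectorField [T3Space M] (x : M) (v : TangentSpace 𝓘(ℝ, E) x) :
    ∃ V : (y : M) → TangentSpace 𝓘(ℝ, E) y, IsContVectorField V ∧ V x = v ∧
      ∃ γ : ℝ → M, γ 0 = x ∧ ∀ᶠ t in 𝓝 0, HasMFDerivAt 𝓘(ℝ, ℝ) 𝓘(ℝ, E) γ t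
        ((1 : ℝ →L[ℝ] ℝ).smulRight (V (γ t))) := by
  classical
  set e := chartAt E x with he_def
  have he : e ∈ IsManifold.maximalAtlas 𝓘(ℝ, E) ∞ M := IsManifold.chart_mem_maximalAtlas _
  have hed : e.MDifferentiable 𝓘(ℝ, E) 𝓘(ℝ, E) := mdifferentiable_chart x
  have hx : x ∈ e.source := mem_chart_source E x
  -- Regularity of M is used here: a support closed in M and contained in the chart domain makes the
  -- extension by zero continuous.
  obtain ⟨K, hK, hKc, hKs⟩ := exists_mem_nhds_isClosed_subset (e.open_source.mem_nhds hx)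
  have hK' : e.target ∩ e.symm ⁻¹' K ∈ 𝓝 (e x) := by
    refine inter_mem (e.open_target.mem_nhds (e.map_source hx)) ?_
    refine (e.continuousAt_symm (e.map_source hx)).preimage_mem_nhds ?_
    rwa [e.left_inv hx]
  obtain ⟨r, hr, hrK⟩ := Metric.nhds_basis_closedBall.mem_iff.1 hK'
  set C : Set M := K ∩ e ⁻¹' Metric.closedBall (e x) r with hC
  have hCc : IsClosed C :=
    (e.continuousOn.mono hKs).preimage_isClosed_of_isClosed hKc Metric.isClosed_closedBall
  -- A tent in the norm, equal to 1 within r/2 and to 0 beyond r. It is only continuous, which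
  -- suffices in an arbitrary Banach space.
  set β : E → ℝ := fun y => max 0 (min 1 (2 - 2 / r * ‖y - e x‖)) with hβ
  have hβc : Continuous β := by fun_prop
  have hβ0 : ∀ y, r ≤ ‖y - e x‖ → β y = 0 := by
    intro y hy
    have : 2 ≤ 2 / r * ‖y - e x‖ := by
      rw [div_mul_eq_mul_div, le_div_iff₀ hr]; linarith
    rw [hβ]
    exact max_eq_left ((min_le_right _ _).trans (by linarith))
  have hβ1 : ∀ y, ‖y - e x‖ ≤ r / 2 → β y = 1 := by
    intro y hy
    have : 2 / r * ‖y - e x‖ ≤ 1 := by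
      rw [div_mul_eq_mul_div, div_le_iff₀ hr]; linarith
    simp only [hβ]
    rw [min_eq_left (by linarith), max_eq_right zero_le_one]
  set w : E := mfderiv 𝓘(ℝ, E) 𝓘(ℝ, E) e x v with hw
  set V : (y : M) → TangentSpace 𝓘(ℝ, E) y := fun y =>
    if y ∈ e.source then (mfderiv 𝓘(ℝ, E) 𝓘(ℝ, E) e.symm (e y) (β (e y) • w) : E) else (0 : E)
    with hV
  have hVe : ∀ y ∈ e.source,
      V y = (mfderiv 𝓘(ℝ, E) 𝓘(ℝ, E) e.symm (e y) (β (e y) • w) : E) := fun y hy => if_pos hy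
  have hVs : ∀ y ∈ e.source, (⟨y, V y⟩ : TangentBundle 𝓘(ℝ, E) M) =
      ⟨e.symm (e y), mfderiv 𝓘(ℝ, E) 𝓘(ℝ, E) e.symm (e y) (β (e y) • w)⟩ := by
    intro y hy
    rw [hVe y hy]
    exact congrArg (fun z : M => (⟨z, (mfderiv 𝓘(ℝ, E) 𝓘(ℝ, E) e.symm (e y) (β (e y) • w) : E)⟩ :
      TangentBundle 𝓘(ℝ, E) M)) (e.left_inv hy).symm
  have hV0 : ∀ y ∈ Cᶜ, V y = 0 := by
    intro y hy
    by_cases hys : y ∈ e.source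
    · rw [hVe y hys]
      have : β (e y) = 0 := by
        apply hβ0
        by_contra hlt
        push Not at hlt
        have hmem : e y ∈ Metric.closedBall (e x) r := by
          rw [Metric.mem_closedBall, dist_eq_norm]; exact hlt.le
        apply hy
        refine ⟨?_, hmem⟩
        have := (hrK hmem).2
        rwa [Set.mem_preimage, e.left_inv hys] at this
      rw [this, zero_smul]
      exact map_zero (mfderiv 𝓘(ℝ, E) 𝓘(ℝ, E) e.symm (e y))
    · exact if_neg hys
  have hVc : IsContVectorField V := by
    have h1 : ContinuousOn (fun y => (⟨y, V y⟩ : TangentBundle 𝓘(ℝ, E) M)) e.source := by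
      refine ContinuousOn.congr ?_ hVs
      refine (continuousOn_mfderiv_symm he).comp (f := fun y => (e y, β (e y) • w))
        (e.continuousOn.prodMk ((hβc.comp_continuousOn e.continuousOn).smul continuousOn_const))
        fun y hy => ⟨e.map_source hy, trivial⟩
    have h2 : ContinuousOn (fun y => (⟨y, V y⟩ : TangentBundle 𝓘(ℝ, E) M)) Cᶜ := by
      have h3 : Continuous (fun y : M => (⟨y, 0⟩ : TangentBundle 𝓘(ℝ, E) M)) :=
        (Bundle.contMDiff_zeroSection ℝ (TangentSpace 𝓘(ℝ, E) : M → Type _)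
          (IB := 𝓘(ℝ, E)) (n := 0)).continuous
      refine h3.continuousOn.congr fun y hy => ?_
      simp only [hV0 y hy]
    refine continuous_iff_continuousAt.2 fun y => ?_
    by_cases hy : y ∈ C
    · exact h1.continuousAt (e.open_source.mem_nhds (hKs hy.1))
    · exact h2.continuousAt (hCc.isOpen_compl.mem_nhds hy)
  -- In the chart the field is the constant w where β = 1, so a straight line is an integral curve
  -- for small t and no existence theorem for differential equations is involved.
  refine ⟨V, hVc, ?_, fun t => e.symm (e x + t • w), by simp [e.left_inv hx], ?_⟩
  · rw [hVe x hx, hβ1 (e x) (by simp; positivity), one_smul]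
    exact congrArg (fun A : E →L[ℝ] E => A v) (hed.symm_comp_deriv hx)
  · have hev : ∀ᶠ t in 𝓝 (0 : ℝ), e x + t • w ∈ e.target ∩ Metric.ball (e x) (r / 2) := by
      have hc : ContinuousAt (fun t : ℝ => e x + t • w) 0 := by fun_prop
      apply hc.eventually_mem
      simp only [zero_smul, add_zero]
      exact inter_mem (e.open_target.mem_nhds (e.map_source hx))
        (Metric.ball_mem_nhds _ (by positivity))
    filter_upwards [hev] with t ht
    have hcd : HasMFDerivAt 𝓘(ℝ, ℝ) 𝓘(ℝ, E) (fun t : ℝ => e x + t • w) t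
        ((1 : ℝ →L[ℝ] ℝ).smulRight w) := by
      have : HasDerivAt (fun t : ℝ => e x + t • w) w t := by
        simpa using ((hasDerivAt_id t).smul_const w).const_add (e x)
      exact this.hasFDerivAt.hasMFDerivAt
    have hcomp := (hed.mdifferentiableAt_symm ht.1).hasMFDerivAt.comp t hcd
    have hVt : V (e.symm (e x + t • w)) =
        mfderiv 𝓘(ℝ, E) 𝓘(ℝ, E) e.symm (e x + t • w) w := by
      have h2 := ht.2
      rw [Metric.mem_ball, dist_eq_norm] at h2
      rw [hVe _ (e.map_target ht.1), e.right_inv ht.1, hβ1 _ h2.le, one_smul]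
    have hL : (1 : ℝ →L[ℝ] ℝ).smulRight (V (e.symm (e x + t • w))) =
        (mfderiv 𝓘(ℝ, E) 𝓘(ℝ, E) e.symm (e x + t • w)).comp
          ((1 : ℝ →L[ℝ] ℝ).smulRight w) := by
      rw [hVt]
      refine ContinuousLinearMap.ext fun s => ?_
      exact (map_smul (mfderiv 𝓘(ℝ, E) 𝓘(ℝ, E) e.symm (e x + t • w)) s w).symm
    rw [hL]
    exact hcomp

/-- The push-forward of a vector field under a diffeomorphism. -/
noncomputable def pushforwardField (f : M ≃ₘ^1⟮𝓘(ℝ, E), 𝓘(ℝ, E)⟯ M)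
    (V : (y : M) → TangentSpace 𝓘(ℝ, E) y) (y : M) : TangentSpace 𝓘(ℝ, E) y :=
  (mfderiv 𝓘(ℝ, E) 𝓘(ℝ, E) f (f.symm y) (V (f.symm y)) : E)

theorem pushforwardField_apply (f : M ≃ₘ^1⟮𝓘(ℝ, E), 𝓘(ℝ, E)⟯ M)
    (V : (y : M) → TangentSpace 𝓘(ℝ, E) y) (x : M) :
    pushforwardField f V (f x) = mfderiv 𝓘(ℝ, E) 𝓘(ℝ, E) f x (V x) :=
  congrArg (fun y : M => (mfderiv 𝓘(ℝ, E) 𝓘(ℝ, E) f y (V y) : E)) (f.symm_apply_apply x)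

theorem IsContVectorField.pushforward {f : M ≃ₘ^1⟮𝓘(ℝ, E), 𝓘(ℝ, E)⟯ M}
    {V : (y : M) → TangentSpace 𝓘(ℝ, E) y} (hV : IsContVectorField V) :
    IsContVectorField (pushforwardField f V) := by
  have h := (f.contMDiff.continuous_tangentMap le_rfl).comp (hV.comp f.symm.continuous)
  refine h.congr fun y => ?_
  exact congrArg (fun z : M => (⟨z, (mfderiv 𝓘(ℝ, E) 𝓘(ℝ, E) f (f.symm y) (V (f.symm y)) : E)⟩ :
      TangentBundle 𝓘(ℝ, E) M)) (f.apply_symm_apply y)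

theorem hasMFDerivAt_pushforwardField (f : M ≃ₘ^1⟮𝓘(ℝ, E), 𝓘(ℝ, E)⟯ M)
    {V : (y : M) → TangentSpace 𝓘(ℝ, E) y} {γ : ℝ → M} {t : ℝ}
    (hγ : HasMFDerivAt 𝓘(ℝ, ℝ) 𝓘(ℝ, E) γ t ((1 : ℝ →L[ℝ] ℝ).smulRight (V (γ t)))) :
    HasMFDerivAt 𝓘(ℝ, ℝ) 𝓘(ℝ, E) (f ∘ γ) t
      ((1 : ℝ →L[ℝ] ℝ).smulRight (pushforwardField f V ((f ∘ γ) t))) := by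
  have h := ((f.contMDiff.mdifferentiable one_ne_zero) (γ t)).hasMFDerivAt.comp t hγ
  have hL : (1 : ℝ →L[ℝ] ℝ).smulRight (pushforwardField f V ((f ∘ γ) t)) =
      (mfderiv 𝓘(ℝ, E) 𝓘(ℝ, E) f (γ t)).comp ((1 : ℝ →L[ℝ] ℝ).smulRight (V (γ t))) := by
    rw [Function.comp_apply, pushforwardField_apply]
    refine ContinuousLinearMap.ext fun s => ?_
    exact (map_smul (mfderiv 𝓘(ℝ, E) 𝓘(ℝ, E) f (γ t)) s (V (γ t))).symm
  rw [hL]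
  exact h

end Geometry

/-! ### Differentiation of expectations and contraction of the Fisher form. -/

namespace StatisticalModel

variable {k : ℝ} {E : Type*} [NormedAddCommGroup E] [NormedSpace ℝ E]
  {M : Type*} [TopologicalSpace M] [ChartedSpace E M] [IsManifold 𝓘(ℝ, E) ∞ M]
  {Ω Ω' : Type*} [MeasurableSpace Ω] [MeasurableSpace Ω']

theorem density_nonneg (S : StatisticalModel k E M Ω) (x : M) :
    ∀ᵐ w ∂S.μ, 0 ≤ S.density x w := by
  filter_upwards [S.density_pos] with w hw using (hw x).le

theorem aemeasurable_ofReal_density (S : StatisticalModel k E M Ω) (x : M) :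
    AEMeasurable (fun w => ENNReal.ofReal (S.density x w)) S.μ :=
  (S.integrable_density x).aestronglyMeasurable.aemeasurable.ennreal_ofReal

theorem integral_p (S : StatisticalModel k E M Ω) (x : M) (φ : Ω → ℝ) :
    ∫ w, φ w ∂(S.p x) = ∫ w, S.density x w * φ w ∂S.μ := by
  rw [S.p_eq x, integral_withDensity_eq_integral_toReal_smul₀ (S.aemeasurable_ofReal_density x)
    (Eventually.of_forall fun _ => ENNReal.ofReal_lt_top)]
  refine integral_congr_ae ?_
  filter_upwards [S.density_nonneg x] with w hw
  simp [ENNReal.toReal_ofReal hw]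

theorem integrable_p_iff (S : StatisticalModel k E M Ω) (x : M) (φ : Ω → ℝ) :
    Integrable φ (S.p x) ↔ Integrable (fun w => S.density x w * φ w) S.μ := by
  rw [S.p_eq x, integrable_withDensity_iff_integrable_smul₀' (S.aemeasurable_ofReal_density x)
    (Eventually.of_forall fun _ => ENNReal.ofReal_lt_top)]
  refine integrable_congr ?_
  filter_upwards [S.density_nonneg x] with w hw
  simp [ENNReal.toReal_ofReal hw]

variable {S : StatisticalModel k E M Ω} {V : (x : M) → TangentSpace 𝓘(ℝ, E) x}

theorem integrable_dlog (hk : 1 ≤ k) (hV : IsContVectorField V) (x : M) :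
    Integrable (S.dlog x (V x)) (S.p x) := by
  have := S.isProbabilityMeasure x
  exact (S.memLp V hV x).integrable (by simpa using ENNReal.ofReal_le_ofReal hk)

theorem integrable_abs_dlog_rpow (hk : 1 ≤ k) (hV : IsContVectorField V) (x : M) :
    Integrable (fun w => |S.dlog x (V x) w| ^ k) (S.p x) := by
  have h := (S.memLp V hV x).integrable_norm_rpow (by simp; linarith) ENNReal.ofReal_ne_top
  rwa [ENNReal.toReal_ofReal (by linarith)] at h

theorem continuous_integral_abs_dlog_rpow (hk : 1 ≤ k) (hV : IsContVectorField V) :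
    Continuous fun x => ∫ w, |S.dlog x (V x) w| ^ k ∂(S.p x) := by
  have hk0 : 0 < k := by linarith
  refine ((S.continuous_norm V hV).rpow_const (p := k) fun x => Or.inr hk0.le).congr fun x => ?_
  have h0 : 0 ≤ ∫ w, |S.dlog x (V x) w| ^ k ∂(S.p x) :=
    integral_nonneg fun w => by positivity
  rw [(S.memLp V hV x).eLpNorm_eq_integral_rpow_norm (by simp; linarith) ENNReal.ofReal_ne_top,
    ENNReal.toReal_ofReal hk0.le]
  change (ENNReal.ofReal ((∫ w, |S.dlog x (V x) w| ^ k ∂(S.p x)) ^ k⁻¹)).toReal ^ k = _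
  rw [ENNReal.toReal_ofReal (by positivity), Real.rpow_inv_rpow h0 hk0.ne']

/-- Along a differentiable curve, the density and the score are continuous. -/
theorem continuousAt_dlog_comp (hV : IsContVectorField V) :
    ∀ᵐ w ∂S.μ, ∀ (γ : ℝ → M) (t : ℝ), ContinuousAt γ t →
      ContinuousAt (fun s => S.dlog (γ s) (V (γ s)) w) t := by
  filter_upwards [S.gateaux] with w hw γ t hγ
  exact (hw.continuous_deriv.comp hV).continuousAt.comp hγ

/-- The exponential of the chain rule for ln p̄. The null set precedes the quantifiers over curves
and times, so one exceptional set serves every point of a curve. -/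
theorem hasDerivAt_density_comp :
    ∀ᵐ w ∂S.μ, ∀ (γ : ℝ → M) (t : ℝ), HasMFDerivAt 𝓘(ℝ, ℝ) 𝓘(ℝ, E) γ t
        ((1 : ℝ →L[ℝ] ℝ).smulRight (V (γ t))) →
      HasDerivAt (fun s => S.density (γ s) w)
        (S.density (γ t) w * S.dlog (γ t) (V (γ t)) w) t := by
  filter_upwards [S.gateaux, S.density_pos] with w hw hpos γ t hγ
  have h := (hw.hasDerivAt_comp hγ).exp
  have h1 : ((1 : ℝ →L[ℝ] ℝ).smulRight (V (γ t))) 1 = V (γ t) :=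
    one_smul ℝ (V (γ t))
  rw [h1] at h
  simp only [Function.comp, Real.exp_log (hpos _)] at h
  exact h

/-- Since |a| ≤ |a|^k + 1 for k ≥ 1, the integrands are dominated by functions whose integrals
converge, by continuity of the L^k norm and because each p(x) has mass one. The Pratt-type theorem
then applies. -/
theorem tendsto_integral_abs_dlog (hk : 1 ≤ k) (hV : IsContVectorField V) {γ : ℝ → M}
    (hγ : HasMFDerivAt 𝓘(ℝ, ℝ) 𝓘(ℝ, E) γ 0 ((1 : ℝ →L[ℝ] ℝ).smulRight (V (γ 0)))) :
    Tendsto (fun t => ∫ w, |S.dlog (γ t) (V (γ t)) w| ∂(S.p (γ t))) (𝓝 0)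
      (𝓝 (∫ w, |S.dlog (γ 0) (V (γ 0)) w| ∂(S.p (γ 0)))) := by
  refine tendsto_of_seq_tendsto fun τ hτ => ?_
  have hint : ∀ x, Integrable (fun w => |S.dlog x (V x) w| ^ k + 1) (S.p x) := fun x => by
    have := S.isProbabilityMeasure x
    exact (integrable_abs_dlog_rpow hk hV x).add (integrable_const _)
  have hval : ∀ x, ∫ w, S.density x w * (|S.dlog x (V x) w| ^ k + 1) ∂S.μ
      = ∫ w, |S.dlog x (V x) w| ^ k ∂(S.p x) + 1 := fun x => by
    have := S.isProbabilityMeasure x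
    rw [← S.integral_p, integral_add (integrable_abs_dlog_rpow hk hV x) (integrable_const _)]
    simp
  have hdens : ∀ᵐ w ∂S.μ, Tendsto (fun n => S.density (γ (τ n)) w) atTop
      (𝓝 (S.density (γ 0) w)) := by
    filter_upwards [hasDerivAt_density_comp (S := S) (V := V)] with w hw
    exact (hw γ 0 hγ).continuousAt.tendsto.comp hτ
  have hscore : ∀ᵐ w ∂S.μ, Tendsto (fun n => |S.dlog (γ (τ n)) (V (γ (τ n))) w|) atTop
      (𝓝 (|S.dlog (γ 0) (V (γ 0)) w|)) := by
    filter_upwards [continuousAt_dlog_comp (S := S) hV] with w hw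
    exact ((hw γ 0 hγ.continuousAt).tendsto.comp hτ).abs
  have key := tendsto_integral_of_limsup_bound_le (μ := S.μ)
    (f := fun n w => S.density (γ (τ n)) w * |S.dlog (γ (τ n)) (V (γ (τ n))) w|)
    (g := fun n w => S.density (γ (τ n)) w * (|S.dlog (γ (τ n)) (V (γ (τ n))) w| ^ k + 1))
    (F := fun w => S.density (γ 0) w * |S.dlog (γ 0) (V (γ 0)) w|)
    (G := fun w => S.density (γ 0) w * (|S.dlog (γ 0) (V (γ 0)) w| ^ k + 1))
    (fun n => (S.integrable_p_iff _ _).1 (integrable_dlog hk hV _).abs)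
    ((S.integrable_p_iff _ _).1 (integrable_dlog hk hV _).abs)
    (fun n => (S.integrable_p_iff _ _).1 (hint _))
    ((S.integrable_p_iff _ _).1 (hint _)) ?_ ?_ ?_ ?_
  · simp only [← S.integral_p] at key
    exact key
  · intro n
    filter_upwards [S.density_nonneg (γ (τ n))] with w hw
    rw [abs_mul, abs_of_nonneg hw, abs_abs]
    refine mul_le_mul_of_nonneg_left ?_ hw
    rcases le_total |S.dlog (γ (τ n)) (V (γ (τ n))) w| 1 with h | h
    · have : 0 ≤ |S.dlog (γ (τ n)) (V (γ (τ n))) w| ^ k := by positivity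
      linarith
    · have := Real.self_le_rpow_of_one_le h hk
      linarith
  · filter_upwards [hdens, hscore] with w h1 h2 using h1.mul h2
  · filter_upwards [hdens, hscore] with w h1 h2
    exact h1.mul ((h2.rpow_const (Or.inr (by linarith))).add_const 1)
  · intro ε hε
    simp only [hval]
    have h := ((continuous_integral_abs_dlog_rpow (S := S) hk hV).tendsto (γ 0)).comp
      (hγ.continuousAt.tendsto.comp hτ)
    filter_upwards [h.eventually (gt_mem_nhds (lt_add_of_pos_right _ hε))] with n hn
    simp only [Function.comp] at hn
    linarith

theorem integral_abs_density_mul_dlog (x : M) (v : TangentSpace 𝓘(ℝ, E) x) :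
    ∫ w, |S.density x w * S.dlog x v w| ∂S.μ = ∫ w, |S.dlog x v w| ∂(S.p x) := by
  rw [S.integral_p]
  refine integral_congr_ae ?_
  filter_upwards [S.density_nonneg x] with w hw
  rw [abs_mul, abs_of_nonneg hw]

/-- Bounds the L¹ norm of the difference quotients of the density by that of the score, up to ε. The
derivative of s ↦ p̄(γ(ts)) has L¹ norm at most |t|(N + ε) on [0, 1], by continuity of the L¹ norm
of the score along γ. -/
theorem integral_abs_density_sub_le (hk : 1 ≤ k) (hV : IsContVectorField V) {γ : ℝ → M}
    (hγ : ∀ᶠ t in 𝓝 0, HasMFDerivAt 𝓘(ℝ, ℝ) 𝓘(ℝ, E) γ t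
      ((1 : ℝ →L[ℝ] ℝ).smulRight (V (γ t)))) {ε : ℝ} (hε : 0 < ε) :
    ∀ᶠ t in 𝓝 0, ∫ w, |S.density (γ t) w - S.density (γ 0) w| ∂S.μ
      ≤ |t| * (∫ w, |S.dlog (γ 0) (V (γ 0)) w| ∂(S.p (γ 0)) + ε) := by
  set N : ℝ := ∫ w, |S.dlog (γ 0) (V (γ 0)) w| ∂(S.p (γ 0)) with hN
  have hN0 : 0 ≤ N := integral_nonneg fun w => abs_nonneg _
  have hev := (tendsto_integral_abs_dlog (S := S) hk hV hγ.self_of_nhds).eventually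
    (gt_mem_nhds (lt_add_of_pos_right _ hε))
  obtain ⟨δ, hδ, hball⟩ := Metric.eventually_nhds_iff.1 (hγ.and hev)
  filter_upwards [Metric.ball_mem_nhds (0 : ℝ) hδ] with t ht
  have ht' : |t| < δ := by simpa using ht
  have hts : ∀ s ∈ Set.Icc (0 : ℝ) 1, dist (t * s) 0 < δ := fun s hs => by
    rw [dist_zero_right, norm_mul, Real.norm_eq_abs, Real.norm_of_nonneg hs.1]
    nlinarith [abs_nonneg t, hs.2]
  have hInt : ∀ x, Integrable (fun w => S.density x w * S.dlog x (V x) w) S.μ := fun x =>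
    (S.integrable_p_iff _ _).1 (integrable_dlog hk hV x)
  have h := lintegral_enorm_sub_le_of_hasDerivAt (μ := S.μ)
    (g := fun s w => S.density (γ (t * s)) w)
    (g' := fun s w => t * (S.density (γ (t * s)) w * S.dlog (γ (t * s)) (V (γ (t * s))) w))
    (C := ENNReal.ofReal (|t| * (N + ε))) ?_ ?_ ?_
  · simp only [mul_one, mul_zero] at h
    have hi : Integrable (fun w => S.density (γ t) w - S.density (γ 0) w) S.μ :=
      (S.integrable_density _).sub (S.integrable_density _)
    have h2 : ∫⁻ w, ‖S.density (γ t) w - S.density (γ 0) w‖ₑ ∂S.μ =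
        ENNReal.ofReal (∫ w, |S.density (γ t) w - S.density (γ 0) w| ∂S.μ) := by
      have := ofReal_integral_norm_eq_lintegral_enorm hi
      exact this.symm
    rw [h2] at h
    exact (ENNReal.ofReal_le_ofReal_iff (by positivity)).1 h
  · filter_upwards [hasDerivAt_density_comp (S := S) (V := V), continuousAt_dlog_comp (S := S) hV]
      with w h1 h2
    refine ⟨fun s hs => ?_, fun s hs => ?_⟩
    · have h3 := (h1 γ _ (hball (hts s hs)).1).comp s (h := fun s => t * s)
        ((hasDerivAt_id s).const_mul t)
      simpa [mul_comm, Function.comp_def] using h3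
    · have h4 : ContinuousAt (fun s : ℝ => t * s) s := by fun_prop
      have h3 := (h1 γ _ (hball (hts s hs)).1).continuousAt.comp (f := fun s => t * s) h4
      have h5 := (h2 γ _ (hball (hts s hs)).1.continuousAt).comp (f := fun s => t * s) h4
      exact (continuousAt_const.mul (h3.mul h5)).continuousWithinAt
  · exact fun s _ => ((hInt _).const_mul t).aestronglyMeasurable.aemeasurable
  · intro s hs
    have h2 := ofReal_integral_norm_eq_lintegral_enorm ((hInt (γ (t * s))).const_mul t)
    rw [← h2]
    apply ENNReal.ofReal_le_ofReal
    simp only [norm_mul t]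
    rw [integral_const_mul]
    refine mul_le_mul_of_nonneg_left ?_ (norm_nonneg t)
    simp only [Real.norm_eq_abs]
    rw [integral_abs_density_mul_dlog]
    exact (hball (hts s hs)).2.le

/-- Expectations of bounded functions can be differentiated under the integral sign. -/
theorem hasDerivAt_integral_p (hk : 1 ≤ k) (hV : IsContVectorField V) {γ : ℝ → M}
    (hγ : ∀ᶠ t in 𝓝 0, HasMFDerivAt 𝓘(ℝ, ℝ) 𝓘(ℝ, E) γ t
      ((1 : ℝ →L[ℝ] ℝ).smulRight (V (γ t)))) {φ : Ω → ℝ} (hφ : Measurable φ) {C : ℝ}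
    (hC : ∀ w, |φ w| ≤ C) :
    HasDerivAt (fun t => ∫ w, φ w ∂(S.p (γ t)))
      (∫ w, φ w * S.dlog (γ 0) (V (γ 0)) w ∂(S.p (γ 0))) 0 := by
  rw [hasDerivAt_iff_tendsto_slope]
  refine tendsto_of_seq_tendsto fun τ hτ => ?_
  obtain ⟨hτ1, hτ2⟩ := tendsto_nhdsWithin_iff.1 hτ
  obtain ⟨n₀, hn₀⟩ := eventually_atTop.1 hτ2
  -- The shift makes every term of the sequence nonzero, not just those from n₀ on.
  rw [← tendsto_add_atTop_iff_nat n₀]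
  have hτ' : Tendsto (fun n => τ (n + n₀)) atTop (𝓝 0) := (tendsto_add_atTop_iff_nat n₀).2 hτ1
  set σ : ℕ → ℝ := fun n => τ (n + n₀) with hσ
  have hσ0 : ∀ n, σ n ≠ 0 := fun n => hn₀ _ (Nat.le_add_left _ _)
  set q : ℕ → Ω → ℝ := fun n w => (σ n)⁻¹ * (S.density (γ (σ n)) w - S.density (γ 0) w) with hq
  set L : Ω → ℝ := fun w => S.density (γ 0) w * S.dlog (γ 0) (V (γ 0)) w with hL
  have hqi : ∀ n, Integrable (q n) S.μ := fun n =>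
    ((S.integrable_density _).sub (S.integrable_density _)).const_mul _
  have hLi : Integrable L S.μ := (S.integrable_p_iff _ _).1 (integrable_dlog hk hV _)
  have hlim : ∀ᵐ w ∂S.μ, Tendsto (fun n => q n w) atTop (𝓝 (L w)) := by
    filter_upwards [hasDerivAt_density_comp (S := S) (V := V)] with w hw
    have h1 := (hw γ 0 hγ.self_of_nhds).tendsto_slope_zero
    have h2 : Tendsto σ atTop (𝓝[≠] 0) :=
      tendsto_nhdsWithin_iff.2 ⟨hτ', Eventually.of_forall hσ0⟩
    have h3 := h1.comp h2
    simpa [Function.comp_def, hq] using h3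
  have hC0 : 0 ≤ C := by
    have := S.isProbabilityMeasure (γ 0)
    obtain ⟨w⟩ := nonempty_of_isProbabilityMeasure (S.p (γ 0))
    exact (abs_nonneg _).trans (hC w)
  have hφa : AEStronglyMeasurable φ S.μ := hφ.aestronglyMeasurable
  have hCa : ∀ᵐ w ∂S.μ, ‖φ w‖ ≤ C := Eventually.of_forall hC
  -- The majorants C|q n| vary with n; it is enough that the limit superior of their integrals is at
  -- most the integral of their limit C|L|.
  have key := tendsto_integral_of_limsup_bound_le (μ := S.μ)
    (f := fun n w => φ w * q n w) (F := fun w => φ w * L w)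
    (g := fun n w => C * |q n w|) (G := fun w => C * |L w|)
    (fun n => (hqi n).bdd_mul hφa hCa) (hLi.bdd_mul hφa hCa)
    (fun n => (hqi n).abs.const_mul C) (hLi.abs.const_mul C)
    (fun n => Eventually.of_forall fun w => by
      rw [abs_mul]; exact mul_le_mul_of_nonneg_right (hC w) (abs_nonneg _))
    (by filter_upwards [hlim] with w hw using hw.const_mul _)
    (by filter_upwards [hlim] with w hw using hw.abs.const_mul _) ?_
  · have hdens : ∀ x, Integrable (fun w => S.density x w * φ w) S.μ := fun x => by
      simpa [mul_comm] using (S.integrable_density x).bdd_mul hφa hCa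
    have e1 : ∀ n, slope (fun t => ∫ w, φ w ∂(S.p (γ t))) 0 (σ n) = ∫ w, φ w * q n w ∂S.μ := by
      intro n
      rw [slope_def_field, S.integral_p, S.integral_p, ← integral_sub (hdens _) (hdens _),
        ← integral_div]
      congr 1 with w
      simp only [hq, sub_zero]
      ring
    have e2 : ∫ w, φ w * S.dlog (γ 0) (V (γ 0)) w ∂(S.p (γ 0)) = ∫ w, φ w * L w ∂S.μ := by
      rw [S.integral_p]
      congr 1 with w
      simp only [hL]
      ring
    rw [e2]
    exact key.congr fun n => (e1 n).symm
  · intro ε hε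
    -- C may be 0, so ε is divided by C + 1.
    have hCpos : 0 < C + 1 := by linarith
    have h1 := hτ'.eventually (integral_abs_density_sub_le (S := S) hk hV hγ
      (ε := ε / (C + 1)) (by positivity))
    filter_upwards [h1] with n hn
    rw [integral_const_mul, integral_const_mul]
    have h2 : ∫ w, |q n w| ∂S.μ ≤ ∫ w, |L w| ∂S.μ + ε / (C + 1) := by
      simp only [hq, abs_mul]
      rw [integral_const_mul, abs_inv, inv_mul_le_iff₀ (abs_pos.2 (hσ0 n))]
      rw [hL, integral_abs_density_mul_dlog]
      exact hn
    have h3 : C * (ε / (C + 1)) ≤ ε := by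
      rw [mul_div_assoc', div_le_iff₀ hCpos]; nlinarith
    nlinarith [mul_le_mul_of_nonneg_left h2 hC0]

theorem memLp_dlog [T3Space M] (x : M) (v : TangentSpace 𝓘(ℝ, E) x) :
    MemLp (S.dlog x v) (ENNReal.ofReal k) (S.p x) := by
  obtain ⟨V, hV, rfl, -⟩ := exists_isContVectorField x v
  exact S.memLp V hV x

/-- The score has mean zero. -/
theorem integral_dlog [T3Space M] (hk : 1 ≤ k) (x : M) (v : TangentSpace 𝓘(ℝ, E) x) :
    ∫ w, S.dlog x v w ∂(S.p x) = 0 := by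
  obtain ⟨V, hV, rfl, γ, rfl, hγ⟩ := exists_isContVectorField x v
  have h := hasDerivAt_integral_p (S := S) hk hV hγ (φ := fun _ => 1) measurable_const (C := 1)
    (by simp)
  have h2 : (fun t => ∫ w, (1 : ℝ) ∂(S.p (γ t))) = fun _ => 1 := by
    funext t
    have := S.isProbabilityMeasure (γ t)
    simp
  rw [h2] at h
  simpa using h.unique (hasDerivAt_const _ _)

/-- The Fisher quadratic form does not increase under restricted Markov morphisms. -/
theorem efisher_le [T3Space M] (hk : 1 ≤ k) {S₂ : StatisticalModel k E M Ω'}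
    {f : M ≃ₘ^1⟮𝓘(ℝ, E), 𝓘(ℝ, E)⟯ M} {T : Kernel Ω Ω'} [IsMarkovKernel T]
    (hT : IsRestrictedMarkovMorphism S S₂ f T) (x : M) (v : TangentSpace 𝓘(ℝ, E) x) :
    S₂.efisher (f x) (mfderiv 𝓘(ℝ, E) 𝓘(ℝ, E) f x v) ≤ S.efisher x v := by
  obtain ⟨V, hV, rfl, γ, rfl, hγ⟩ := exists_isContVectorField x v
  have := S.isProbabilityMeasure (γ 0)
  have hW := hV.pushforward (f := f)
  have hγ2 : ∀ᶠ t in 𝓝 0, HasMFDerivAt 𝓘(ℝ, ℝ) 𝓘(ℝ, E) (f ∘ γ) t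
      ((1 : ℝ →L[ℝ] ℝ).smulRight (pushforwardField f V ((f ∘ γ) t))) := by
    filter_upwards [hγ] with t ht using hasMFDerivAt_pushforwardField f ht
  rw [← pushforwardField_apply f V (γ 0)]
  unfold efisher
  rw [hT (γ 0)]
  refine lintegral_sq_le_of_dual (integrable_dlog hk hV _) ?_ ?_
  · rw [← hT (γ 0)]
    exact integrable_dlog hk hW _
  -- Both sides of the duality are the derivative at 0 of one function of t, the expectation of φ
  -- under p₂(f(γ t)), also written as the expectation of Tφ under p₁(γ t).
  · rintro φ hφ ⟨C, hC⟩
    have h2 := hasDerivAt_integral_p (S := S₂) hk hW hγ2 hφ hC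
    have hφ' : Measurable fun w => ∫ w', φ w' ∂(T w) :=
      (hφ.stronglyMeasurable.integral_kernel (κ := T)).measurable
    have h1 := hasDerivAt_integral_p (S := S) hk hV hγ hφ' (C := C) fun w => by
      simpa using norm_integral_le_of_norm_le_const (μ := T w)
        (Eventually.of_forall fun w => (show ‖φ w‖ ≤ C from hC w))
    have h3 : (fun t => ∫ w, φ w ∂(S₂.p ((f ∘ γ) t))) =
        fun t => ∫ w, (∫ w', φ w' ∂(T w)) ∂(S.p (γ t)) := by
      funext t
      rw [Function.comp_apply, hT (γ t)]
      have := S.isProbabilityMeasure (γ t)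
      exact Kernel.integral_comp (κ := Kernel.const Unit (S.p (γ t))) (η := T) (a := ())
        (Integrable.of_bound hφ.aestronglyMeasurable C (Eventually.of_forall hC))
    rw [h3] at h2
    rw [← hT (γ 0)]
    exact h2.unique h1

theorem integrable_sq_of_memLp {x : M} {v : TangentSpace 𝓘(ℝ, E) x} (h2k : 2 ≤ k)
    (h : MemLp (S.dlog x v) (ENNReal.ofReal k) (S.p x)) :
    Integrable (fun w => S.dlog x v w ^ 2) (S.p x) := by
  have := S.isProbabilityMeasure x
  exact (h.mono_exponent (by simpa using ENNReal.ofReal_le_ofReal h2k)).integrable_sq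

theorem ofReal_fisher {x : M} {v : TangentSpace 𝓘(ℝ, E) x}
    (h : Integrable (fun w => S.dlog x v w ^ 2) (S.p x)) :
    ENNReal.ofReal (S.fisher x v v) = S.efisher x v := by
  unfold fisher efisher
  simp only [← pow_two]
  exact ofReal_integral_eq_lintegral_ofReal h (Eventually.of_forall fun w => sq_nonneg _)

/-- The Bochner integral in `fisher` takes the value 0 on non-integrable squares, so the real
inequality is deduced from the one in [0, ∞] under integrability on both sides. -/
theorem fisher_le [T3Space M] (hk : 1 ≤ k) {S₂ : StatisticalModel k E M Ω'}
    {f : M ≃ₘ^1⟮𝓘(ℝ, E), 𝓘(ℝ, E)⟯ M} {T : Kernel Ω Ω'} [IsMarkovKernel T]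
    (hT : IsRestrictedMarkovMorphism S S₂ f T) (x : M) (v : TangentSpace 𝓘(ℝ, E) x)
    (h₁ : Integrable (fun w => S.dlog x v w ^ 2) (S.p x))
    (h₂ : Integrable (fun w => S₂.dlog (f x) (mfderiv 𝓘(ℝ, E) 𝓘(ℝ, E) f x v) w ^ 2)
      (S₂.p (f x))) :
    S₂.fisher (f x) (mfderiv 𝓘(ℝ, E) 𝓘(ℝ, E) f x v) (mfderiv 𝓘(ℝ, E) 𝓘(ℝ, E) f x v)
      ≤ S.fisher x v v := by
  have h := efisher_le hk hT x v
  rw [← ofReal_fisher h₁, ← ofReal_fisher h₂] at h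
  refine (ENNReal.ofReal_le_ofReal_iff ?_).1 h
  exact integral_nonneg fun w => mul_self_nonneg _

end StatisticalModel

/-! ### Chentsov's theorem on the open simplices. -/

section Chentsov

/-- The interior of the probability simplex. -/
def IsPosProb {n : ℕ} (ν : Fin n → ℝ) : Prop := (∀ i, 0 < ν i) ∧ ∑ i, ν i = 1

/-- The action of a Markov matrix on (signed) measures. -/
def push {n m : ℕ} (A : Fin n → Fin m → ℝ) (u : Fin n → ℝ) (j : Fin m) : ℝ := ∑ i, A i j * u i

theorem sum_push {n m : ℕ} {A : Fin n → Fin m → ℝ} (hA : ∀ i, ∑ j, A i j = 1) (u : Fin n → ℝ) :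
    ∑ j, push A u j = ∑ i, u i := by
  simp only [push]
  rw [Finset.sum_comm]
  simp_rw [← Finset.sum_mul, hA, one_mul]

/-- A family of symmetric bilinear forms `Q n ν` on measures on `Fin n`, indexed by the points of
the open probability simplices, that is continuous and monotone under positive Markov matrices. -/
structure IsMonotoneFamily (Q : ∀ n : ℕ, (Fin n → ℝ) → LinearMap.BilinForm ℝ (Fin n → ℝ)) :
    Prop where
  symm : ∀ n ν u v, Q n ν u v = Q n ν v u
  tendsto : ∀ (n : ℕ) (ν : ℕ → Fin n → ℝ) (ν₀ : Fin n → ℝ) (u : ℕ → Fin n → ℝ) (u₀ : Fin n → ℝ),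
    (∀ s, IsPosProb (ν s)) → IsPosProb ν₀ → (∀ s, ∑ i, u s i = 0) → ∑ i, u₀ i = 0 →
    Tendsto ν atTop (𝓝 ν₀) → Tendsto u atTop (𝓝 u₀) →
    Tendsto (fun s => Q n (ν s) (u s) (u s)) atTop (𝓝 (Q n ν₀ u₀ u₀))
  le : ∀ (n m : ℕ) (A : Fin n → Fin m → ℝ), (∀ i j, 0 < A i j) → (∀ i, ∑ j, A i j = 1) →
    ∀ ν u : Fin n → ℝ, IsPosProb ν → ∑ i, u i = 0 →
    Q m (push A ν) (push A u) (push A u) ≤ Q n ν u u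

theorem IsPosProb.pos_card {n : ℕ} {ν : Fin n → ℝ} (h : IsPosProb ν) : 0 < n := by
  rcases Nat.eq_zero_or_pos n with rfl | h0
  · simpa using h.2
  · exact h0

namespace IsMonotoneFamily

variable {Q : ∀ n : ℕ, (Fin n → ℝ) → LinearMap.BilinForm ℝ (Fin n → ℝ)}

/-- Mixing A with the uniform matrix, (1 - ε)A + ε/m, makes all entries positive; continuity lets ε
tend to 0 as long as the limit `push A ν` stays in the open simplex. This admits matrices with
zeros, as splitting and merging of atoms require. -/
theorem le_of_nonneg (hQ : IsMonotoneFamily Q) {n m : ℕ} {A : Fin n → Fin m → ℝ}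
    (hA : ∀ i j, 0 ≤ A i j) (hA1 : ∀ i, ∑ j, A i j = 1) {ν u : Fin n → ℝ} (hν : IsPosProb ν)
    (hpos : ∀ j, 0 < push A ν j) (hu : ∑ i, u i = 0) :
    Q m (push A ν) (push A u) (push A u) ≤ Q n ν u u := by
  have hAν : IsPosProb (push A ν) := ⟨hpos, by rw [sum_push hA1, hν.2]⟩
  have hm : (0 : ℝ) < m := by exact_mod_cast hAν.pos_card
  set ε : ℕ → ℝ := fun s => 1 / ((s : ℝ) + 1) with hε
  have hε0 : ∀ s, 0 < ε s := fun s => by positivity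
  have hε1 : ∀ s, ε s ≤ 1 := fun s => by
    rw [hε]; simp only; rw [div_le_one (by positivity)]; linarith [Nat.cast_nonneg (α := ℝ) s]
  have hεt : Tendsto ε atTop (𝓝 0) := tendsto_one_div_add_atTop_nhds_zero_nat
  set As : ℕ → Fin n → Fin m → ℝ := fun s i j => (1 - ε s) * A i j + ε s / m with hAs
  have hAs0 : ∀ s i j, 0 < As s i j := fun s i j => by
    have := mul_nonneg (sub_nonneg.2 (hε1 s)) (hA i j)
    have := div_pos (hε0 s) hm
    simp only [hAs]; linarith
  have hAs1 : ∀ s i, ∑ j, As s i j = 1 := fun s i => by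
    simp only [hAs]
    rw [Finset.sum_add_distrib, ← Finset.mul_sum, hA1]
    simp only [Finset.sum_const, Finset.card_univ, Fintype.card_fin, nsmul_eq_mul]
    field_simp
    ring
  have hpush : ∀ s (v : Fin n → ℝ),
      push (As s) v = fun j => (1 - ε s) * push A v j + ε s / m * ∑ i, v i := fun s v => by
    funext j
    simp only [push, hAs, add_mul, Finset.sum_add_distrib, Finset.mul_sum, mul_assoc]
  have hlim : ∀ v : Fin n → ℝ, Tendsto (fun s => push (As s) v) atTop (𝓝 (push A v)) := by
    intro v
    simp_rw [hpush]
    refine tendsto_pi_nhds.2 fun j => ?_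
    have h := (((tendsto_const_nhds (x := (1 : ℝ))).sub hεt).mul_const (push A v j)).add
      ((hεt.div_const (m : ℝ)).mul_const (∑ i, v i))
    simpa using h
  refine le_of_tendsto' (hQ.tendsto m (fun s => push (As s) ν) _ (fun s => push (As s) u) _
    (fun s => ⟨fun j => ?_, by rw [sum_push (hAs1 s), hν.2]⟩) hAν
    (fun s => by rw [sum_push (hAs1 s), hu]) (by rw [sum_push hA1, hu]) (hlim ν) (hlim u))
    fun s => hQ.le n m (As s) (hAs0 s) (hAs1 s) ν u hν hu
  have : Nonempty (Fin n) := ⟨⟨0, hν.pos_card⟩⟩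
  exact Finset.sum_pos (fun i _ => mul_pos (hAs0 s i j) (hν.1 i)) Finset.univ_nonempty

/-- Invariance under the embedding that splits the mass at `i` among the points over `i`. -/
theorem eq_of_split (hQ : IsMonotoneFamily Q) {n N : ℕ} (π : Fin N → Fin n) (κ : Fin N → ℝ)
    (hκ : ∀ l, 0 < κ l) (hκ1 : ∀ i, ∑ l, (if π l = i then κ l else 0) = 1)
    {ν u : Fin n → ℝ} (hν : IsPosProb ν) (hu : ∑ i, u i = 0) :
    Q N (fun l => κ l * ν (π l)) (fun l => κ l * u (π l)) (fun l => κ l * u (π l))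
      = Q n ν u u := by
  -- A splits atoms and R merges them again. On measures R undoes A, so monotonicity under both
  -- gives equality.
  set A : Fin n → Fin N → ℝ := fun i l => if π l = i then κ l else 0 with hA
  set R : Fin N → Fin n → ℝ := fun l i => if π l = i then 1 else 0 with hR
  have hpA : ∀ v : Fin n → ℝ, push A v = fun l => κ l * v (π l) := fun v => by
    funext l
    simp [push, hA]
  have hpR : ∀ v : Fin n → ℝ, push R (fun l => κ l * v (π l)) = v := fun v => by
    funext i
    have : ∀ l, R l i * (κ l * v (π l)) = (if π l = i then κ l else 0) * v i := fun l => by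
      simp only [hR]
      split_ifs with h
      · rw [h, one_mul]
      · simp
    simp only [push, this]
    rw [← Finset.sum_mul, hκ1, one_mul]
  have hsum : ∀ v : Fin n → ℝ, ∑ l, κ l * v (π l) = ∑ i, v i := fun v => by
    have := sum_push (A := A) hκ1 v
    rwa [hpA] at this
  have hν' : IsPosProb fun l => κ l * ν (π l) :=
    ⟨fun l => mul_pos (hκ l) (hν.1 _), by rw [hsum, hν.2]⟩
  apply le_antisymm
  · have h := hQ.le_of_nonneg (A := A) (fun i l => by simp only [hA]; split_ifs <;> simp [(hκ l).le])
      hκ1 hν (by rw [hpA]; exact hν'.1) hu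
    rwa [hpA, hpA] at h
  · have h := hQ.le_of_nonneg (A := R) (fun l i => by simp only [hR]; split_ifs <;> simp)
      (fun l => by simp [hR]) hν' (by rw [hpR]; exact hν.1) (u := fun l => κ l * u (π l))
      (by rw [hsum, hu])
    rwa [hpR, hpR] at h

theorem eq_comp_swap (hQ : IsMonotoneFamily Q) {n : ℕ} (a b : Fin n)
    {ν u : Fin n → ℝ} (hν : IsPosProb ν) (hu : ∑ i, u i = 0) :
    Q n (ν ∘ Equiv.swap a b) (u ∘ Equiv.swap a b) (u ∘ Equiv.swap a b) = Q n ν u u := by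
  have h := hQ.eq_of_split (Equiv.swap a b) (fun _ => 1) (fun _ => one_pos) (fun i => by
    have : ∀ l, (Equiv.swap a b l = i) ↔ l = Equiv.swap a b i := fun l => by
      rw [Equiv.swap_apply_eq_iff]
    simp [this]) hν hu
  simpa [Function.comp_def] using h

end IsMonotoneFamily

/-- On vectors with sum zero, a quadratic form is determined by its values on differences of basis
vectors. -/
theorem bilin_eq_sum_single_sub {n : ℕ} (b : LinearMap.BilinForm ℝ (Fin n → ℝ))
    (hb : ∀ u v, b u v = b v u) {u : Fin n → ℝ} (hu : ∑ i, u i = 0) :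
    b u u = -(1 / 2) * ∑ i, ∑ j, u i * u j *
      b (Pi.single i 1 - Pi.single j 1) (Pi.single i 1 - Pi.single j 1) := by
  have h1 : b u u = ∑ i, ∑ j, u i * u j * b (Pi.single i 1) (Pi.single j 1) := by
    conv_lhs => rw [← (Pi.basisFun ℝ (Fin n)).sum_repr u]
    simp only [Pi.basisFun_repr, Pi.basisFun_apply, map_sum, LinearMap.sum_apply, map_smul,
      LinearMap.smul_apply, smul_eq_mul]
    rw [Finset.sum_comm]
    refine Finset.sum_congr rfl fun i _ => ?_
    rw [Finset.mul_sum]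
    refine Finset.sum_congr rfl fun j _ => ?_
    ring
  -- The diagonal terms contain a factor ∑ u = 0 after summation, so only the mixed terms survive,
  -- with coefficient -2.
  have h2 : ∀ i j, u i * u j * b (Pi.single i 1 - Pi.single j 1) (Pi.single i 1 - Pi.single j 1)
      = (u i * b (Pi.single i 1) (Pi.single i 1)) * u j
        + u i * (u j * b (Pi.single j 1) (Pi.single j 1))
        - 2 * (u i * u j * b (Pi.single i 1) (Pi.single j 1)) := fun i j => by
    simp only [map_sub, LinearMap.sub_apply]
    rw [hb (Pi.single j 1) (Pi.single i 1)]
    ring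
  simp_rw [h2, Finset.sum_sub_distrib, Finset.sum_add_distrib, ← Finset.mul_sum, ← Finset.sum_mul,
    hu]
  rw [h1]
  simp

namespace IsMonotoneFamily

variable {Q : ∀ n : ℕ, (Fin n → ℝ) → LinearMap.BilinForm ℝ (Fin n → ℝ)}

theorem isPosProb_uniform {n : ℕ} (hn : 0 < n) : IsPosProb (fun _ : Fin n => (n : ℝ)⁻¹) := by
  have : (0 : ℝ) < n := by exact_mod_cast hn
  exact ⟨fun _ => by positivity, by simp [this.ne']⟩

/-- At the uniform distribution, permutation invariance determines the form up to a constant. -/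
theorem exists_uniform (hQ : IsMonotoneFamily Q) (n : ℕ) :
    ∃ c : ℝ, ∀ u : Fin n → ℝ, ∑ i, u i = 0 →
      Q n (fun _ => (n : ℝ)⁻¹) u u = c * ∑ i, u i ^ 2 := by
  rcases Nat.eq_zero_or_pos n with rfl | hn
  · exact ⟨0, fun u _ => by
      have h : u = 0 := Subsingleton.elim _ _
      rw [h, LinearMap.map_zero]; simp⟩
  have hpos := isPosProb_uniform hn
  set q : Fin n → Fin n → ℝ := fun i j => Q n (fun _ => (n : ℝ)⁻¹)
    (Pi.single i 1 - Pi.single j 1) (Pi.single i 1 - Pi.single j 1) with hq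
  have hq_comm : ∀ i j, q i j = q j i := fun i j => by
    simp only [hq]
    rw [← neg_sub (Pi.single j (1 : ℝ) : Fin n → ℝ) (Pi.single i 1)]
    simp only [map_neg, LinearMap.neg_apply, neg_neg]
  -- A transposition fixing i moves the second index. Together with symmetry of q, such moves
  -- connect all pairs of distinct indices.
  have hq_swap : ∀ i j j', i ≠ j → i ≠ j' → q i j' = q i j := fun i j j' h h' => by
    have e := hQ.eq_comp_swap j j' hpos (u := Pi.single i 1 - Pi.single j 1) (by simp)
    have e2 : (Pi.single i (1 : ℝ) - Pi.single j 1 : Fin n → ℝ) ∘ Equiv.swap j j'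
        = Pi.single i 1 - Pi.single j' 1 := by
      funext l
      simp only [Function.comp, Pi.sub_apply, Pi.single_apply, Equiv.swap_apply_eq_iff,
        Equiv.swap_apply_left, Equiv.swap_apply_of_ne_of_ne h h']
    rw [e2] at e
    exact e
  obtain ⟨c, hc⟩ : ∃ c, ∀ i j, i ≠ j → q i j = c := by
    by_cases h : ∃ i j : Fin n, i ≠ j
    · obtain ⟨a, b, hab⟩ := h
      refine ⟨q a b, fun i j hij => ?_⟩
      by_cases hib : i = b
      · rw [hq_comm a b, hib]
        exact hq_swap b a j hab.symm (hib ▸ hij)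
      · rw [hq_swap i b j hib hij, hq_comm i b, hq_comm a b]
        exact hq_swap b a i hab.symm (Ne.symm hib)
    · push Not at h
      exact ⟨0, fun i j hij => absurd (h i j) hij⟩
  -- Because ∑ u = 0, the sum of u i * u j over i ≠ j is -∑ u i ^ 2, and the factor -1/2 turns this
  -- into c/2.
  refine ⟨c / 2, fun u hu => ?_⟩
  rw [bilin_eq_sum_single_sub _ (hQ.symm n _) hu]
  have h1 : ∀ i j, u i * u j * Q n (fun _ => (n : ℝ)⁻¹)
      (Pi.single i 1 - Pi.single j 1) (Pi.single i 1 - Pi.single j 1)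
      = u i * u j * c - (if i = j then u i * u j * c else 0) := fun i j => by
    split_ifs with hij
    · subst hij; simp
    · rw [sub_zero]; exact congrArg _ (hc i j hij)
  simp_rw [h1, Finset.sum_sub_distrib, ← Finset.sum_mul, ← Finset.mul_sum, hu]
  simp only [mul_zero, Finset.sum_const_zero, zero_mul, Finset.sum_ite_eq, Finset.mem_univ,
    if_true, ← Finset.sum_mul, ← pow_two]
  ring

/-- Splitting the atom i of mass κ i / N into κ i equal atoms yields the uniform distribution on N
points. The vector entry u i becomes κ i copies of u i / κ i, contributing u i ^ 2 / κ i. -/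
theorem eq_rational (hQ : IsMonotoneFamily Q) {C : ℕ → ℝ}
    (hC : ∀ n (u : Fin n → ℝ), ∑ i, u i = 0 →
      Q n (fun _ => (n : ℝ)⁻¹) u u = C n * ∑ i, u i ^ 2)
    {n : ℕ} (hn : 0 < n) (κ : Fin n → ℕ) (hκ : ∀ i, 0 < κ i) {u : Fin n → ℝ}
    (hu : ∑ i, u i = 0) :
    Q n (fun i => (κ i : ℝ) / (∑ j, κ j : ℕ)) u u
      = C (∑ j, κ j) * ∑ i, u i ^ 2 / κ i := by
  set N := ∑ j, κ j with hN
  have hκ' : ∀ i, (0 : ℝ) < κ i := fun i => by exact_mod_cast hκ i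
  have : Nonempty (Fin n) := ⟨⟨0, hn⟩⟩
  have hN0 : (0 : ℝ) < N := by
    exact_mod_cast Finset.sum_pos (fun i _ => hκ i) Finset.univ_nonempty
  set π : Fin N → Fin n := fun l => (finSigmaFinEquiv.symm l).1 with hπ
  have hsum : ∀ f : Fin n → ℝ, ∑ l, f (π l) = ∑ i, κ i * f i := fun f => by
    rw [← (finSigmaFinEquiv (n := κ)).sum_comp]
    simp only [hπ, Equiv.symm_apply_apply]
    rw [Fintype.sum_sigma]
    simp
  have h := hQ.eq_of_split π (fun l => ((κ (π l) : ℝ))⁻¹) (fun l => inv_pos.2 (hκ' _))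
    (fun i => by
      rw [hsum fun j => if j = i then ((κ j : ℝ))⁻¹ else 0]
      simp [(hκ' i).ne'])
    (ν := fun i => (κ i : ℝ) / N) (u := u)
    ⟨fun i => div_pos (hκ' i) hN0, by
      rw [← Finset.sum_div, div_eq_one_iff_eq hN0.ne', hN]; push_cast; rfl⟩ hu
  rw [← h]
  have h1 : (fun l => ((κ (π l) : ℝ))⁻¹ * ((κ (π l) : ℝ) / N)) = fun _ => (N : ℝ)⁻¹ := by
    funext l
    field_simp [(hκ' (π l)).ne']
  rw [h1, hC N _ (by
    rw [hsum fun i => ((κ i : ℝ))⁻¹ * u i, ← hu]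
    exact Finset.sum_congr rfl fun i _ => by rw [mul_inv_cancel_left₀ (hκ' i).ne']),
    hsum fun i => (((κ i : ℝ))⁻¹ * u i) ^ 2]
  congr 1
  refine Finset.sum_congr rfl fun i _ => ?_
  field_simp [(hκ' i).ne']

/-- **Chentsov's theorem**: a monotone family is a multiple of the Fisher metric. -/
theorem exists_eq_fisher (hQ : IsMonotoneFamily Q) :
    ∃ c : ℝ, ∀ (n : ℕ) (ν : Fin n → ℝ), IsPosProb ν → ∀ u v : Fin n → ℝ,
      ∑ i, u i = 0 → ∑ i, v i = 0 → Q n ν u v = c * ∑ i, u i * v i / ν i := by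
  choose C hC using hQ.exists_uniform
  -- Splits every atom of the uniform distribution into k. The bound 2 ≤ n provides a nonzero vector
  -- of sum zero; for n ≤ 1 the value C n is arbitrary.
  have hscale : ∀ n k : ℕ, 2 ≤ n → 0 < k → C n / n = C (n * k) / ((n * k : ℕ) : ℝ) := by
    intro n k hn hk
    have hn0 : (0 : ℝ) < n := by exact_mod_cast (by omega : 0 < n)
    have hk0 : (0 : ℝ) < k := by exact_mod_cast hk
    set u : Fin n → ℝ := Pi.single ⟨0, by omega⟩ 1 - Pi.single ⟨1, by omega⟩ 1 with hu_def
    have hu : ∑ i, u i = 0 := by simp [hu_def]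
    have hu2 : 0 < ∑ i, u i ^ 2 := by
      refine Finset.sum_pos' (fun i _ => sq_nonneg _) ⟨⟨0, by omega⟩, Finset.mem_univ _, ?_⟩
      simp [hu_def]
    have h := hQ.eq_rational hC (by omega) (fun _ : Fin n => k) (fun _ => hk) hu
    simp only [Finset.sum_const, Finset.card_univ, Fintype.card_fin, smul_eq_mul] at h
    have h1 : (fun _ : Fin n => (k : ℝ) / ((n * k : ℕ) : ℝ)) = fun _ => (n : ℝ)⁻¹ := by
      funext _; push_cast; field_simp
    rw [h1, hC n u hu, ← Finset.sum_div] at h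
    have h2 : C n = C (n * k) / k := by
      have h3 : C n * ∑ i, u i ^ 2 = C (n * k) / k * ∑ i, u i ^ 2 := by rw [h]; ring
      exact mul_right_cancel₀ hu2.ne' h3
    rw [h2]; push_cast; field_simp
  refine ⟨C 2 / 2, fun n ν hν => ?_⟩
  -- N and 2 are compared through their common multiple 2N.
  have hCn : ∀ N : ℕ, 2 ≤ N → C N / N = C 2 / 2 := fun N hN => by
    rw [hscale N 2 hN two_pos, mul_comm N 2, ← hscale 2 N le_rfl (by omega)]
    norm_num
  have hquad : ∀ u : Fin n → ℝ, ∑ i, u i = 0 →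
      Q n ν u u = C 2 / 2 * ∑ i, u i * u i / ν i := by
    intro u hu
    rcases Nat.lt_or_ge n 2 with hn | hn
    · have h1 : n = 1 := by have := hν.pos_card; omega
      subst h1
      have : u = 0 := by
        funext i
        rw [Subsingleton.elim i 0]
        simpa using hu
      simp [this]
    have : Nonempty (Fin n) := ⟨⟨0, by omega⟩⟩
    -- Rational approximation of ν: adding 1 to the floor keeps each weight positive, and
    -- normalising by the sum of the κ s j keeps the total mass equal to 1.
    set κ : ℕ → Fin n → ℕ := fun s i => ⌊ν i * ((s + 1 : ℕ) : ℝ)⌋₊ + 1 with hκ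
    have hκ0 : ∀ s i, 0 < κ s i := fun s i => Nat.succ_pos _
    have hS0 : ∀ s, 0 < ∑ j, κ s j := fun s =>
      Finset.sum_pos (fun i _ => hκ0 s i) Finset.univ_nonempty
    have hS2 : ∀ s, 2 ≤ ∑ j, κ s j := fun s => by
      have h1 : ∑ j : Fin n, 1 ≤ ∑ j, κ s j := Finset.sum_le_sum fun j _ => hκ0 s j
      simp at h1
      omega
    set νs : ℕ → Fin n → ℝ := fun s i => (κ s i : ℝ) / (∑ j, κ s j : ℕ) with hνs
    have hνs0 : ∀ s, IsPosProb (νs s) := fun s => by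
      have h0 : (0 : ℝ) < (∑ j, κ s j : ℕ) := by exact_mod_cast hS0 s
      refine ⟨fun i => div_pos (by exact_mod_cast hκ0 s i) h0, ?_⟩
      simp only [hνs]
      rw [← Finset.sum_div, div_eq_one_iff_eq h0.ne']; push_cast; rfl
    have hκt : ∀ i, Tendsto (fun s => (κ s i : ℝ) / ((s + 1 : ℕ) : ℝ)) atTop (𝓝 (ν i)) := by
      intro i
      have h1 : Tendsto (fun s : ℕ => ((s + 1 : ℕ) : ℝ)) atTop atTop :=
        tendsto_natCast_atTop_atTop.comp (tendsto_add_atTop_nat 1)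
      have h2 := (tendsto_nat_floor_mul_div_atTop (hν.1 i).le).comp h1
      have h3 := h2.add (tendsto_inv_atTop_zero.comp h1)
      rw [add_zero] at h3
      refine h3.congr fun s => ?_
      simp only [hκ, Function.comp]
      push_cast
      ring
    have hνt : Tendsto νs atTop (𝓝 ν) := by
      refine tendsto_pi_nhds.2 fun i => ?_
      have h1 := tendsto_finsetSum Finset.univ fun j _ => hκt j
      rw [hν.2] at h1
      have h2 := (hκt i).div h1 one_ne_zero
      rw [div_one] at h2
      refine h2.congr fun s => ?_
      simp only [hνs, Pi.div_apply]
      rw [← Finset.sum_div, div_div_div_cancel_right₀ (by positivity)]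
      push_cast
      rfl
    have hlim := hQ.tendsto n νs ν (fun _ => u) u hνs0 hν (fun _ => hu) hu hνt tendsto_const_nhds
    have hval : ∀ s, Q n (νs s) u u = C 2 / 2 * ∑ i, u i * u i / νs s i := fun s => by
      have h0 : (0 : ℝ) < (∑ j, κ s j : ℕ) := by exact_mod_cast hS0 s
      rw [hQ.eq_rational hC (by omega) (κ s) (hκ0 s) hu, ← hCn _ (hS2 s), div_mul_eq_mul_div,
        mul_div_assoc, Finset.sum_div]
      congr 1
      refine Finset.sum_congr rfl fun i _ => ?_
      have h1 : (0 : ℝ) < κ s i := by exact_mod_cast hκ0 s i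
      simp only [hνs]
      field_simp
    refine tendsto_nhds_unique hlim ?_
    simp_rw [hval]
    refine (tendsto_finsetSum _ fun i _ => ?_).const_mul _
    exact tendsto_const_nhds.div ((tendsto_pi_nhds.1 hνt) i) (hν.1 i).ne'
  intro u v hu hv
  have h1 := hquad (u + v) (by simp [Finset.sum_add_distrib, hu, hv])
  have h2 : ∑ i, (u + v) i * (u + v) i / ν i
      = ∑ i, u i * u i / ν i + ∑ i, v i * v i / ν i + 2 * ∑ i, u i * v i / ν i := by
    rw [Finset.mul_sum, ← Finset.sum_add_distrib, ← Finset.sum_add_distrib]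
    refine Finset.sum_congr rfl fun i _ => ?_
    simp only [Pi.add_apply]
    ring
  rw [h2] at h1
  simp only [map_add, LinearMap.add_apply] at h1
  rw [hquad u hu, hquad v hv, hQ.symm n ν v u] at h1
  linarith

end IsMonotoneFamily

end Chentsov

/-! ### Finite models: point masses and scores. -/

namespace FiniteStatisticalModel

variable {k : ℝ} {E : Type*} [NormedAddCommGroup E] [NormedSpace ℝ E]
  {M : Type*} [TopologicalSpace M] [ChartedSpace E M] [IsManifold 𝓘(ℝ, E) ∞ M] {n m : ℕ}

/-- Full support leaves no nonempty null set, so the almost-everywhere axioms hold at each point. -/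
theorem forall_of_ae (S : FiniteStatisticalModel k E M n) {P : Fin n → Prop}
    (h : ∀ᵐ i ∂S.μ, P i) (i : Fin n) : P i := by
  by_contra hi
  exact S.full_support i (measure_mono_null (by simpa using hi) (ae_iff.1 h))

theorem integral_eq_sum (S : FiniteStatisticalModel k E M n) (x : M) (φ : Fin n → ℝ) :
    ∫ i, φ i ∂(S.p x) = ∑ i, (S.p x).real {i} * φ i := by
  have := S.isProbabilityMeasure x
  rw [integral_fintype Integrable.of_finite]
  rfl

theorem real_singleton (S : FiniteStatisticalModel k E M n) (x : M) (i : Fin n) :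
    (S.p x).real {i} = S.density x i * S.μ.real {i} := by
  have := S.isProbabilityMeasure x
  have h := S.toStatisticalModel.integral_p x (Set.indicator {i} 1)
  rw [integral_indicator_one (measurableSet_singleton i)] at h
  rw [h]
  have h2 : ∀ w, S.density x w * Set.indicator {i} (1 : Fin n → ℝ) w
      = Set.indicator {i} (S.density x) w := fun w => by
    by_cases hw : w = i <;> simp [hw]
  simp_rw [h2]
  rw [integral_indicator (measurableSet_singleton i), integral_singleton, smul_eq_mul, mul_comm]

theorem real_singleton_pos (S : FiniteStatisticalModel k E M n) (x : M) (i : Fin n) :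
    0 < (S.p x).real {i} := by
  have := S.sigmaFinite
  rw [S.real_singleton]
  refine mul_pos (S.forall_of_ae S.density_pos i x) (ENNReal.toReal_pos (S.full_support i) ?_)
  exact measure_singleton_lt_top.ne

theorem isPosProb (S : FiniteStatisticalModel k E M n) (x : M) :
    IsPosProb fun i => (S.p x).real {i} := by
  have := S.isProbabilityMeasure x
  exact ⟨S.real_singleton_pos x, by simp⟩

theorem continuous_real_singleton (S : FiniteStatisticalModel k E M n) (i : Fin n) :
    Continuous fun x => (S.p x).real {i} := by
  refine ((continuous_setIntegral {i}).comp S.continuous_L1).congr fun x => ?_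
  simp only [Function.comp]
  rw [S.real_singleton, setIntegral_congr_ae (g := S.density x) (measurableSet_singleton i)
    (by filter_upwards [(S.integrable_density x).coeFn_toL1] with w hw _ using hw),
    integral_singleton, smul_eq_mul, mul_comm]

theorem continuous_dlog (S : FiniteStatisticalModel k E M n)
    {V : (x : M) → TangentSpace 𝓘(ℝ, E) x} (hV : IsContVectorField V) (i : Fin n) :
    Continuous fun x => S.toStatisticalModel.dlog x (V x) i :=
  (S.forall_of_ae S.gateaux i).continuous_deriv.comp hV

theorem fisher_eq_sum (S : FiniteStatisticalModel k E M n) (x : M)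
    (V W : TangentSpace 𝓘(ℝ, E) x) :
    S.toStatisticalModel.fisher x V W = ∑ i, (S.p x).real {i} *
      (S.toStatisticalModel.dlog x V i * S.toStatisticalModel.dlog x W i) :=
  S.integral_eq_sum x _

end FiniteStatisticalModel

/-! ### The Fisher metric as a field on finite models. -/

namespace FiniteField

theorem isLocalQuadratic_fisher (k : ℝ) : (fisher.{u} k).IsLocalQuadratic := by
  refine ⟨fun n μ => LinearMap.mk₂ ℝ (fun g h => ∑ i, μ.real {i} * (g i * h i)) ?_ ?_ ?_ ?_, ?_, ?_⟩
  · intro f g h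
    rw [← Finset.sum_add_distrib]
    exact Finset.sum_congr rfl fun i _ => by simp only [Pi.add_apply]; ring
  · intro c g h
    rw [Finset.smul_sum]
    exact Finset.sum_congr rfl fun i _ => by simp only [Pi.smul_apply, smul_eq_mul]; ring
  · intro f g h
    rw [← Finset.sum_add_distrib]
    exact Finset.sum_congr rfl fun i _ => by simp only [Pi.add_apply]; ring
  · intro c g h
    rw [Finset.smul_sum]
    exact Finset.sum_congr rfl fun i _ => by simp only [Pi.smul_apply, smul_eq_mul]; ring
  · intro n μ g h
    simp only [LinearMap.mk₂_apply, mul_comm (g _)]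
  · intro E _ _ _ M _ _ _ _ n S x V W
    rw [LinearMap.mk₂_apply]
    exact S.fisher_eq_sum x V W

theorem isWeaklyContinuous_fisher (k : ℝ) : (fisher.{u} k).IsWeaklyContinuous := by
  intro E _ _ _ M _ _ _ _ n S V W hV hW
  simp only [fisher, S.fisher_eq_sum]
  exact continuous_finsetSum _ fun i _ =>
    (S.continuous_real_singleton i).mul ((S.continuous_dlog hV i).mul (S.continuous_dlog hW i))

theorem isMonotone_fisher {k : ℝ} (hk : 1 ≤ k) : (fisher.{u} k).IsMonotone := by
  intro E _ _ _ M _ _ _ _ n m S₁ S₂ f T _ hT _ x V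
  have := S₁.isProbabilityMeasure x
  have := S₂.isProbabilityMeasure (f x)
  exact StatisticalModel.fisher_le hk hT x V Integrable.of_finite Integrable.of_finite

end FiniteField

/-! ### Finite models built from C¹ families of probability vectors. -/

section Construction

variable {E : Type*} [NormedAddCommGroup E] [NormedSpace ℝ E]

theorem gateauxDeriv_eq_fderiv {G : E → ℝ} (hG : Differentiable ℝ G) (x : E)
    (v : TangentSpace 𝓘(ℝ, E) x) : gateauxDeriv (E := E) G x v = fderiv ℝ G x v := by
  simp only [gateauxDeriv, chartAt_self_eq, OpenPartialHomeomorph.refl_symm,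
    OpenPartialHomeomorph.refl_apply, Function.comp_id]
  exact (hG x).lineDeriv_eq_fderiv

theorem isContVectorField_iff {V : (x : E) → TangentSpace 𝓘(ℝ, E) x} :
    IsContVectorField V ↔ Continuous (fun x => (V x : E)) := by
  constructor
  · intro h
    exact continuous_snd.comp (f := fun x : E => ((x, V x) : E × E))
      ((tangentBundleModelSpaceHomeomorph 𝓘(ℝ, E)).continuous.comp h)
  · intro h
    exact continuous_tangentBundle_mk.comp (continuous_id.prodMk h)

/-- Every chart of the maximal atlas has to be treated, not only the identity; the chain rule with
the inverse chart reduces each to the Fréchet derivative. -/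
theorem isContGateauxDiff_of_contDiff {G : E → ℝ} (hG : ContDiff ℝ 1 G) :
    IsContGateauxDiff (E := E) G := by
  have hd : Differentiable ℝ G := hG.differentiable one_ne_zero
  refine ⟨?_, ?_, ?_⟩
  · intro e he x hx v
    have hed : e.MDifferentiable 𝓘(ℝ, E) 𝓘(ℝ, E) :=
      ⟨fun y hy => ((contMDiffAt_of_mem_maximalAtlas he hy).mdifferentiableAt
          (by simp)).mdifferentiableWithinAt,
        fun y hy => ((contMDiffAt_symm_of_mem_maximalAtlas he hy).mdifferentiableAt
          (by simp)).mdifferentiableWithinAt⟩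
    rw [gateauxDeriv_eq_fderiv hd]
    obtain ⟨A, hA, hA1⟩ : ∃ A : E →L[ℝ] E, HasFDerivAt e.symm A (e x) ∧
        A (mfderiv 𝓘(ℝ, E) 𝓘(ℝ, E) e x v) = v :=
      ⟨_, (hed.mdifferentiableAt_symm (e.map_source hx)).hasMFDerivAt.hasFDerivAt,
        congrArg (fun A : E →L[ℝ] E => A v) (hed.symm_comp_deriv hx)⟩
    have h1 : HasFDerivAt G (fderiv ℝ G x) (e.symm (e x)) := by
      rw [e.left_inv hx]; exact (hd x).hasFDerivAt
    have h2 := (h1.comp (e x) hA).hasLineDerivAt (mfderiv 𝓘(ℝ, E) 𝓘(ℝ, E) e x v)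
    have h3 : (fderiv ℝ G x ∘L A) (mfderiv 𝓘(ℝ, E) 𝓘(ℝ, E) e x v) = fderiv ℝ G x v :=
      congrArg (fderiv ℝ G x) hA1
    rw [h3] at h2
    exact h2
  · intro x
    simp only [gateauxDeriv_eq_fderiv hd]
    exact (fderiv ℝ G x).toLinearMap.isLinear
  · simp only [gateauxDeriv_eq_fderiv hd]
    have h : Continuous fun z : E × E => fderiv ℝ G z.1 z.2 :=
      hG.continuous_fderiv_apply one_ne_zero
    exact h.comp (tangentBundleModelSpaceHomeomorph 𝓘(ℝ, E)).continuous

/-- The measure on `Fin n` with the given point masses. -/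
noncomputable def finMeasure {n : ℕ} (ν : Fin n → ℝ) : Measure (Fin n) :=
  Measure.count.withDensity fun i => ENNReal.ofReal (ν i)

theorem finMeasure_singleton {n : ℕ} (ν : Fin n → ℝ) (i : Fin n) :
    finMeasure ν {i} = ENNReal.ofReal (ν i) := by
  rw [finMeasure, withDensity_apply _ (measurableSet_singleton i), lintegral_singleton,
    Measure.count_singleton, mul_one]

theorem isProbabilityMeasure_finMeasure {n : ℕ} {ν : Fin n → ℝ} (h0 : ∀ i, 0 ≤ ν i)
    (h1 : ∑ i, ν i = 1) : IsProbabilityMeasure (finMeasure ν) := by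
  constructor
  rw [finMeasure, withDensity_apply _ MeasurableSet.univ, Measure.restrict_univ,
    lintegral_fintype]
  simp only [Measure.count_singleton, mul_one]
  rw [← ENNReal.ofReal_sum_of_nonneg fun i _ => h0 i, h1, ENNReal.ofReal_one]

theorem eq_finMeasure {n : ℕ} (P : Measure (Fin n)) [IsFiniteMeasure P] :
    P = finMeasure fun i => P.real {i} := by
  refine Measure.ext_of_singleton fun i => ?_
  rw [finMeasure_singleton, ofReal_measureReal]

/-- A smooth family of positive probability vectors, as a finite statistical model. -/
noncomputable def smoothModel {k : ℝ} (hk : 1 ≤ k) {n : ℕ} (q : E → Fin n → ℝ)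
    (hq : ∀ i, ContDiff ℝ 1 fun x => q x i) (hpos : ∀ x, IsPosProb (q x)) :
    FiniteStatisticalModel k E E n where
  μ := Measure.count
  sigmaFinite := inferInstance
  p x := finMeasure (q x)
  density := q
  integrable_density x := Integrable.of_finite
  p_eq x := rfl
  continuous_L1 := by
    rw [continuous_iff_continuousAt]
    intro x
    rw [ContinuousAt, tendsto_iff_dist_tendsto_zero]
    have h : ∀ y, dist ((Integrable.of_finite (f := q y) (μ := Measure.count)).toL1 (q y))
        ((Integrable.of_finite (f := q x) (μ := Measure.count)).toL1 (q x))
        = ∑ i, |q y i - q x i| := fun y => by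
      rw [dist_eq_norm, ← Integrable.toL1_sub, L1.norm_of_fun_eq_integral_norm,
        integral_fintype Integrable.of_finite]
      simp [Measure.real]
    simp only [h]
    have h2 : Continuous fun y => ∑ i, |q y i - q x i| :=
      continuous_finsetSum _ fun i _ => ((hq i).continuous.sub continuous_const).abs
    simpa using h2.tendsto x
  density_pos := Eventually.of_forall fun i x => (hpos x).1 i
  gateaux := Eventually.of_forall fun i =>
    isContGateauxDiff_of_contDiff ((hq i).log fun x => ((hpos x).1 i).ne')
  memLp V _ x := by
    have := isProbabilityMeasure_finMeasure (fun i => ((hpos x).1 i).le) (hpos x).2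
    exact MemLp.of_discrete
  continuous_norm V hV := by
    have hk0 : 0 < k := by linarith
    have hc : ∀ i, Continuous fun x =>
        gateauxDeriv (E := E) (fun y => Real.log (q y i)) x (V x) := fun i =>
      (isContGateauxDiff_of_contDiff ((hq i).log fun x => ((hpos x).1 i).ne')).continuous_deriv.comp
        hV
    have h : ∀ x, (eLpNorm (fun i => gateauxDeriv (E := E) (fun y => Real.log (q y i)) x (V x))
        (ENNReal.ofReal k) (finMeasure (q x))).toReal =
        (∑ i, q x i * |gateauxDeriv (E := E) (fun y => Real.log (q y i)) x (V x)| ^ k) ^ k⁻¹ := by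
      intro x
      have := isProbabilityMeasure_finMeasure (fun i => ((hpos x).1 i).le) (hpos x).2
      have h0 : ∀ i, 0 ≤ q x i := fun i => ((hpos x).1 i).le
      rw [MemLp.of_discrete.eLpNorm_eq_integral_rpow_norm (by simp; linarith)
        ENNReal.ofReal_ne_top, integral_fintype Integrable.of_finite,
        ENNReal.toReal_ofReal hk0.le]
      simp only [Measure.real, finMeasure_singleton, ENNReal.toReal_ofReal (h0 _), smul_eq_mul,
        Real.norm_eq_abs]
      rw [ENNReal.toReal_ofReal]
      exact Real.rpow_nonneg (Finset.sum_nonneg fun i _ =>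
        mul_nonneg (h0 i) (Real.rpow_nonneg (abs_nonneg _) _)) _
    simp only [h]
    refine Continuous.rpow_const ?_ fun x => Or.inr (by positivity)
    exact continuous_finsetSum _ fun i _ => (hq i).continuous.mul
      ((hc i).abs.rpow_const fun x => Or.inr hk0.le)
  isProbabilityMeasure x :=
    isProbabilityMeasure_finMeasure (fun i => ((hpos x).1 i).le) (hpos x).2
  full_support i := by simp

theorem dlog_smoothModel {k : ℝ} (hk : 1 ≤ k) {n : ℕ} {q : E → Fin n → ℝ}
    (hq : ∀ i, ContDiff ℝ 1 fun x => q x i) (hpos : ∀ x, IsPosProb (q x)) (x v : E) (i : Fin n) :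
    (smoothModel hk q hq hpos).toStatisticalModel.dlog x v i
      = fderiv ℝ (fun y => q y i) x v / q x i := by
  have hd : Differentiable ℝ fun y => q y i := (hq i).differentiable one_ne_zero
  have h := gateauxDeriv_eq_fderiv (hd.log fun x => ((hpos x).1 i).ne') x v
  refine h.trans ?_
  rw [fderiv.log (hd x) ((hpos x).1 i).ne']
  simp [div_eq_inv_mul]

end Construction

/-! ### The exponential family, lifted to the universe of the parameter manifolds. -/

section ExponentialFamily

/-- The natural parameter space of the exponential family of all distributions on `Fin n`. -/
abbrev ParamSpace (n : ℕ) : Type u := ULift.{u} (Fin n) → ℝ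

variable {n m : ℕ}

/-- The partition function. -/
noncomputable def partitionFn (θ : ParamSpace.{u} n) : ℝ := ∑ j : Fin n, Real.exp (θ ⟨j⟩)

/-- The exponential family of all positive distributions on `Fin n`. -/
noncomputable def expFamily (θ : ParamSpace.{u} n) (i : Fin n) : ℝ :=
  Real.exp (θ ⟨i⟩ - Real.log (partitionFn θ))

theorem partitionFn_pos (hn : 0 < n) (θ : ParamSpace.{u} n) : 0 < partitionFn θ := by
  have : Nonempty (Fin n) := ⟨⟨0, hn⟩⟩
  exact Finset.sum_pos (fun j _ => Real.exp_pos _) Finset.univ_nonempty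

theorem isPosProb_expFamily (hn : 0 < n) (θ : ParamSpace.{u} n) : IsPosProb (expFamily θ) := by
  refine ⟨fun i => Real.exp_pos _, ?_⟩
  have hZ := partitionFn_pos hn θ
  simp only [expFamily, Real.exp_sub, Real.exp_log hZ, ← Finset.sum_div]
  exact div_self hZ.ne'

theorem contDiff_expFamily (hn : 0 < n) (i : Fin n) :
    ContDiff ℝ 1 fun θ : ParamSpace.{u} n => expFamily θ i := by
  refine ContDiff.exp ((contDiff_apply ℝ ℝ _).sub (ContDiff.log ?_ fun θ =>
    (partitionFn_pos hn θ).ne'))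
  exact ContDiff.sum fun j _ => (contDiff_apply ℝ ℝ _).exp

/-- The natural parameter of a positive distribution. -/
noncomputable def logParam (ν : Fin n → ℝ) : ParamSpace.{u} n := fun j => Real.log (ν j.down)

theorem partitionFn_logParam {ν : Fin n → ℝ} (hν : IsPosProb ν) :
    partitionFn (logParam.{u} ν) = 1 := by
  simp only [partitionFn, logParam, Real.exp_log (hν.1 _), hν.2]

theorem expFamily_logParam {ν : Fin n → ℝ} (hν : IsPosProb ν) :
    expFamily (logParam.{u} ν) = ν := by
  funext i
  simp only [expFamily, partitionFn_logParam hν, Real.log_one, sub_zero, logParam,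
    Real.exp_log (hν.1 i)]

/-- At `logParam ν` the partition function is 1, so the derivative of its logarithm is the ν-mean of
a. Hence a direction of ν-mean zero is its own score. -/
theorem fderiv_expFamily {ν : Fin n → ℝ} (hν : IsPosProb ν) (a : ParamSpace.{u} n) (i : Fin n) :
    fderiv ℝ (fun θ : ParamSpace.{u} n => expFamily θ i) (logParam ν) a
      = ν i * (a ⟨i⟩ - ∑ j, ν j * a ⟨j⟩) := by
  have hp : ∀ j : Fin n, HasFDerivAt (fun θ : ParamSpace.{u} n => θ ⟨j⟩)
      (ContinuousLinearMap.proj ⟨j⟩ : ParamSpace.{u} n →L[ℝ] ℝ) (logParam ν) := fun j =>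
    (ContinuousLinearMap.proj (R := ℝ) (φ := fun _ : ULift.{u} (Fin n) => ℝ) ⟨j⟩).hasFDerivAt
  have hZ : HasFDerivAt (fun θ : ParamSpace.{u} n => partitionFn θ) _ (logParam ν) :=
    HasFDerivAt.fun_sum fun j (_ : j ∈ Finset.univ) => (hp j).exp
  have hZ1 := partitionFn_logParam.{u} hν
  have h := ((hp i).sub (hZ.log (by rw [hZ1]; exact one_ne_zero))).exp
  have h2 : HasFDerivAt (fun θ : ParamSpace.{u} n => expFamily θ i) _ (logParam ν) := h
  rw [h2.fderiv]
  simp [hZ1, logParam, Real.exp_log (hν.1 _)]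

end ExponentialFamily

/-- The transition kernel given by a Markov matrix. -/
noncomputable def matrixKernel {n m : ℕ} (A : Fin n → Fin m → ℝ) : Kernel (Fin n) (Fin m) where
  toFun i := finMeasure (A i)
  measurable' := Measurable.of_discrete

theorem bind_matrixKernel {n m : ℕ} {A : Fin n → Fin m → ℝ} (hA : ∀ i j, 0 < A i j)
    {ν : Fin n → ℝ} (hν : IsPosProb ν) :
    (finMeasure ν).bind (matrixKernel A) = finMeasure (push A ν) := by
  refine Measure.ext_of_singleton fun j => ?_
  rw [Measure.bind_apply (measurableSet_singleton j) (Kernel.aemeasurable _), lintegral_fintype,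
    finMeasure_singleton, push, ENNReal.ofReal_sum_of_nonneg fun i _ =>
      mul_nonneg (hA i j).le (hν.1 i).le]
  refine Finset.sum_congr rfl fun i _ => ?_
  rw [ENNReal.ofReal_mul (hA i j).le, finMeasure_singleton]
  exact congrArg (· * _) (finMeasure_singleton (A i) j)

theorem isPosProb_push {n m : ℕ} {A : Fin n → Fin m → ℝ} (hA : ∀ i j, 0 < A i j)
    (hA1 : ∀ i, ∑ j, A i j = 1) {ν : Fin n → ℝ} (hν : IsPosProb ν) : IsPosProb (push A ν) := by
  refine ⟨fun j => ?_, by rw [sum_push hA1, hν.2]⟩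
  have : Nonempty (Fin n) := ⟨⟨0, hν.pos_card⟩⟩
  exact Finset.sum_pos (fun i _ => mul_pos (hA i j) (hν.1 i)) Finset.univ_nonempty

/-- Pointwise division by `ν`, which turns measures into densities with respect to `ν`. -/
noncomputable def divMap {n : ℕ} (ν : Fin n → ℝ) : (Fin n → ℝ) →ₗ[ℝ] (Fin n → ℝ) where
  toFun u i := u i / ν i
  map_add' u v := by funext i; simp [add_div]
  map_smul' c u := by funext i; simp [mul_div_assoc]

/-! ### Reduction of uniqueness to the simplices. -/

namespace FiniteField

variable {k : ℝ} {F : FiniteField.{u} k}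
  {B : ∀ n : ℕ, Measure (Fin n) → LinearMap.BilinForm ℝ (Fin n → ℝ)}

/-- A tangent vector u to the simplex at ν has score u/ν, whence the pullback of B by `divMap ν`.
Nothing is assumed about B itself beyond symmetry, so continuity and monotonicity are obtained from
F on the exponential family and its images under A. -/
theorem isMonotoneFamily (hk : 1 ≤ k) (hsymm : ∀ n μ g h, B n μ g h = B n μ h g)
    (hB : ∀ (E : Type u) [NormedAddCommGroup E] [NormedSpace ℝ E] [CompleteSpace E]
      (M : Type u) [TopologicalSpace M] [T3Space M] [ChartedSpace E M] [IsManifold 𝓘(ℝ, E) ∞ M]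
      (n : ℕ) (S : FiniteStatisticalModel k E M n) (x : M) (V W : TangentSpace 𝓘(ℝ, E) x),
      F E M n S x V W
        = B n (S.p x) (S.toStatisticalModel.dlog x V) (S.toStatisticalModel.dlog x W))
    (hc : F.IsWeaklyContinuous) (hm : F.IsMonotonePositive) :
    IsMonotoneFamily fun n ν => (B n (finMeasure ν)).compl₁₂ (divMap ν) (divMap ν) where
  symm n ν u v := hsymm _ _ _ _
  tendsto n ν ν₀ u u₀ hν hν₀ hu hu₀ htν htu := by
    have hn := hν₀.pos_card
    set S : FiniteStatisticalModel k (ParamSpace.{u} n) (ParamSpace.{u} n) n :=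
      smoothModel hk expFamily (contDiff_expFamily hn) (isPosProb_expFamily hn) with hS
    set e : Fin n → ParamSpace.{u} n := fun i => Pi.single ⟨i⟩ 1 with he
    set H : Fin n → Fin n → ParamSpace.{u} n → ℝ := fun i j θ =>
      F (ParamSpace.{u} n) (ParamSpace.{u} n) n S θ (e i) (e j) with hH
    have hHc : ∀ i j, Continuous (H i j) := fun i j =>
      hc _ _ n S (fun _ => e i) (fun _ => e j) (isContVectorField_iff.2 continuous_const)
        (isContVectorField_iff.2 continuous_const)
    have hp : ∀ {ν : Fin n → ℝ}, IsPosProb ν → S.p (logParam ν) = finMeasure ν := fun {ν} hν =>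
      congrArg finMeasure (expFamily_logParam hν)
    -- The coordinate field e i has score 1_{i} - ν i. With coefficients u i / ν i the constants add
    -- up to -∑ u = 0, so the form at ν is a combination, with continuous coefficients, of the
    -- continuous functions H.
    have hd : ∀ {ν : Fin n → ℝ}, IsPosProb ν → ∀ {u : Fin n → ℝ}, ∑ i, u i = 0 →
        divMap ν u = ∑ i, (u i / ν i) • S.toStatisticalModel.dlog (logParam ν) (e i) := by
      intro ν hν u hu
      funext l
      have h1 : ∀ i, S.toStatisticalModel.dlog (logParam ν) (e i) l
          = (if i = l then 1 else 0) - ν i := fun i => by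
        refine (dlog_smoothModel hk (contDiff_expFamily hn) (isPosProb_expFamily hn)
          (logParam ν) (e i) l).trans ?_
        rw [fderiv_expFamily hν, expFamily_logParam hν, mul_div_cancel_left₀ _ (hν.1 l).ne']
        simp [he, Pi.single_apply, eq_comm]
      simp only [Finset.sum_apply, Pi.smul_apply, smul_eq_mul, h1, mul_sub,
        Finset.sum_sub_distrib, div_mul_cancel₀ _ (hν.1 _).ne', hu]
      simp [divMap]
    have hval : ∀ {ν : Fin n → ℝ}, IsPosProb ν → ∀ {u : Fin n → ℝ}, ∑ i, u i = 0 →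
        (B n (finMeasure ν)).compl₁₂ (divMap ν) (divMap ν) u u =
          ∑ i, ∑ j, (u i / ν i) * (u j / ν j) * H j i (logParam ν) := by
      intro ν hν u hu
      have hHB : ∀ i j, H i j (logParam ν) = B n (finMeasure ν)
          (S.toStatisticalModel.dlog (logParam ν) (e i))
          (S.toStatisticalModel.dlog (logParam ν) (e j)) := fun i j => by
        rw [← hp hν]
        exact hB _ _ n S _ _ _
      rw [LinearMap.compl₁₂_apply, hd hν hu]
      simp only [map_sum, LinearMap.sum_apply, map_smul, LinearMap.smul_apply, smul_eq_mul,
        hHB, Finset.mul_sum, mul_assoc]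
    rw [hval hν₀ hu₀]
    simp only [hval (hν _) (hu _)]
    have hlog : Tendsto (fun s => logParam.{u} (ν s)) atTop (𝓝 (logParam ν₀)) :=
      tendsto_pi_nhds.2 fun j => (tendsto_pi_nhds.1 htν j.down).log (hν₀.1 _).ne'
    have hdiv : ∀ i, Tendsto (fun s => u s i / ν s i) atTop (𝓝 (u₀ i / ν₀ i)) := fun i =>
      (tendsto_pi_nhds.1 htu i).div (tendsto_pi_nhds.1 htν i) (hν₀.1 i).ne'
    exact tendsto_finsetSum _ fun i _ => tendsto_finsetSum _ fun j _ =>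
      ((hdiv i).mul (hdiv j)).mul (((hHc j i).tendsto _).comp hlog)
  le n m A hA hA1 ν u hν hu := by
    have hn := hν.pos_card
    have hq₂ : ∀ j, ContDiff ℝ 1 fun θ : ParamSpace.{u} n => push A (expFamily θ) j := fun j =>
      ContDiff.sum fun i _ => contDiff_const.mul (contDiff_expFamily hn i)
    have hpos₂ : ∀ θ : ParamSpace.{u} n, IsPosProb (push A (expFamily θ)) := fun θ =>
      isPosProb_push hA hA1 (isPosProb_expFamily hn θ)
    -- The direction u/ν has ν-mean ∑ u = 0, so the family moves from ν with velocity exactly u, and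
    -- its image under A with velocity `push A u`.
    set a : ParamSpace.{u} n := fun j => u j.down / ν j.down with ha
    have hfd : ∀ i, fderiv ℝ (fun θ : ParamSpace.{u} n => expFamily θ i) (logParam ν) a = u i :=
      fun i => by
        rw [fderiv_expFamily hν]
        simp only [ha, mul_div_cancel₀ _ (hν.1 _).ne', hu, sub_zero]
    have hd₁ : (smoothModel hk expFamily (contDiff_expFamily hn)
        (isPosProb_expFamily hn)).toStatisticalModel.dlog (logParam.{u} ν) a = divMap ν u := by
      funext i
      refine (dlog_smoothModel hk _ _ (logParam.{u} ν) a i).trans ?_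
      rw [hfd, expFamily_logParam hν]
      rfl
    have hd₂ : (smoothModel hk (fun θ : ParamSpace.{u} n => push A (expFamily θ)) hq₂
        hpos₂).toStatisticalModel.dlog (logParam.{u} ν) a = divMap (push A ν) (push A u) := by
      funext j
      refine (dlog_smoothModel hk _ _ (logParam.{u} ν) a j).trans ?_
      rw [expFamily_logParam hν]
      have h1 : HasFDerivAt (fun θ : ParamSpace.{u} n => push A (expFamily θ) j) _ (logParam ν) :=
        HasFDerivAt.fun_sum fun i (_ : i ∈ Finset.univ) =>
          (((contDiff_expFamily.{u} hn i).differentiable one_ne_zero)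
            (logParam ν)).hasFDerivAt.const_mul (A i j)
      rw [h1.fderiv]
      simp only [sum_apply, smul_apply, hfd, smul_eq_mul]
      rfl
    have hT : IsMarkovKernel (matrixKernel A) :=
      ⟨fun i => isProbabilityMeasure_finMeasure (fun j => (hA i j).le) (hA1 i)⟩
    have key := hm (ParamSpace.{u} n) (ParamSpace.{u} n) n m
      (smoothModel hk expFamily (contDiff_expFamily hn) (isPosProb_expFamily hn))
      (smoothModel hk (fun θ => push A (expFamily θ)) hq₂ hpos₂)
      (Diffeomorph.refl 𝓘(ℝ, ParamSpace.{u} n) (ParamSpace.{u} n) 1) (matrixKernel A)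
      (fun θ => (bind_matrixKernel hA (isPosProb_expFamily hn θ)).symm)
      -- The reference measure of the target is counting measure, so A is its own positive kernel
      -- density.
      ⟨A, ⟨Measurable.of_discrete, fun i j => (hA i j).le, fun i => rfl⟩, hA⟩ (logParam ν) a
    have hid : mfderiv 𝓘(ℝ, ParamSpace.{u} n) 𝓘(ℝ, ParamSpace.{u} n)
        (Diffeomorph.refl 𝓘(ℝ, ParamSpace.{u} n) (ParamSpace.{u} n) 1) (logParam ν) a = a := by
      rw [Diffeomorph.coe_refl, mfderiv_id]
      rfl
    have hd₂' : (smoothModel hk (fun θ : ParamSpace.{u} n => push A (expFamily θ)) hq₂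
        hpos₂).toStatisticalModel.dlog (logParam.{u} ν)
          (mfderiv 𝓘(ℝ, ParamSpace.{u} n) 𝓘(ℝ, ParamSpace.{u} n)
            (Diffeomorph.refl 𝓘(ℝ, ParamSpace.{u} n) (ParamSpace.{u} n) 1) (logParam ν) a)
        = divMap (push A ν) (push A u) := by
      rw [hid]; exact hd₂
    have key' := (hB _ _ _ _ _ _ _).ge.trans (key.trans (hB _ _ _ _ _ _ _).le)
    change B m (finMeasure (push A (expFamily (logParam.{u} ν))))
      ((smoothModel hk (fun θ : ParamSpace.{u} n => push A (expFamily θ)) hq₂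
        hpos₂).toStatisticalModel.dlog (logParam.{u} ν) _)
      ((smoothModel hk (fun θ : ParamSpace.{u} n => push A (expFamily θ)) hq₂
        hpos₂).toStatisticalModel.dlog (logParam.{u} ν) _) ≤
      B n (finMeasure (expFamily (logParam.{u} ν))) _ _ at key'
    rw [hd₂', hd₁, expFamily_logParam hν] at key'
    exact key'

/-- A weakly continuous monotone local quadratic form field is a multiple of the Fisher metric. -/
theorem exists_eq_fisher (hk : 1 ≤ k) (hF : F.IsLocalQuadratic) (hc : F.IsWeaklyContinuous)
    (hm : F.IsMonotonePositive) :
    ∃ c : ℝ, ∀ (E : Type u) [NormedAddCommGroup E] [NormedSpace ℝ E] [CompleteSpace E]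
      (M : Type u) [TopologicalSpace M] [T3Space M] [ChartedSpace E M]
      [IsManifold 𝓘(ℝ, E) ∞ M] (n : ℕ) (S : FiniteStatisticalModel k E M n)
      (x : M) (V W : TangentSpace 𝓘(ℝ, E) x),
      F E M n S x V W = c * S.toStatisticalModel.fisher x V W := by
  obtain ⟨B, hsymm, hB⟩ := hF
  obtain ⟨c, hcQ⟩ := (isMonotoneFamily hk hsymm hB hc hm).exists_eq_fisher
  refine ⟨c, fun E _ _ _ M _ _ _ _ n S x V W => ?_⟩
  have := S.isProbabilityMeasure x
  set ν : Fin n → ℝ := fun i => (S.p x).real {i} with hν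
  have hpos : ∀ i, ν i ≠ 0 := fun i => (S.real_singleton_pos x i).ne'
  -- Scores have mean zero, so ν times a score is a sum-zero vector, to which Chentsov's theorem
  -- applies; dividing by ν recovers the score.
  have hsum : ∀ V : TangentSpace 𝓘(ℝ, E) x,
      ∑ i, ν i * S.toStatisticalModel.dlog x V i = 0 := fun V =>
    (S.integral_eq_sum x _).symm.trans (StatisticalModel.integral_dlog hk x V)
  have hdiv : ∀ g : Fin n → ℝ, divMap ν (fun i => ν i * g i) = g := fun g => by
    funext i
    exact mul_div_cancel_left₀ _ (hpos i)
  have h := hcQ n ν (S.isPosProb x) _ _ (hsum V) (hsum W)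
  rw [LinearMap.compl₁₂_apply, hdiv, hdiv, ← eq_finMeasure (S.p x)] at h
  rw [hB, h, S.fisher_eq_sum]
  congr 1
  refine Finset.sum_congr rfl fun i _ => ?_
  change ν i * S.toStatisticalModel.dlog x V i * (ν i * S.toStatisticalModel.dlog x W i) / ν i
    = ν i * (S.toStatisticalModel.dlog x V i * S.toStatisticalModel.dlog x W i)
  have := hpos i
  field_simp

end FiniteField

end InfoGeo

/-! ### Assembly of the two statements. -/

theorem mainTheorem7 (k : ℝ) (hk : 1 ≤ k) :
    (∀ (E : Type*) [NormedAddCommGroup E] [NormedSpace ℝ E] [CompleteSpace E]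
      (M : Type*) [TopologicalSpace M] [T3Space M] [ChartedSpace E M] [IsManifold 𝓘(ℝ, E) ∞ M]
      (d₁ d₂ : ℕ)
      (Ω₁ : Type*) [TopologicalSpace Ω₁] [ChartedSpace (EuclideanSpace ℝ (Fin d₁)) Ω₁]
      [IsManifold (𝓡 d₁) ∞ Ω₁] [MeasurableSpace Ω₁] [BorelSpace Ω₁]
      (Ω₂ : Type*) [TopologicalSpace Ω₂] [ChartedSpace (EuclideanSpace ℝ (Fin d₂)) Ω₂]
      [IsManifold (𝓡 d₂) ∞ Ω₂] [MeasurableSpace Ω₂] [BorelSpace Ω₂]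
      (S₁ : InfoGeo.StatisticalModel k E M Ω₁) (S₂ : InfoGeo.StatisticalModel k E M Ω₂),
      IsProbabilityMeasure S₁.μ → InfoGeo.IsLebesgueMeasure d₁ S₁.μ →
      IsProbabilityMeasure S₂.μ → InfoGeo.IsLebesgueMeasure d₂ S₂.μ →
      ∀ (f : M ≃ₘ^1⟮𝓘(ℝ, E), 𝓘(ℝ, E)⟯ M) (T : Kernel Ω₁ Ω₂) [IsMarkovKernel T],
        InfoGeo.IsRestrictedMarkovMorphism S₁ S₂ f T → InfoGeo.IsRepresentable T S₂.μ →
        ∀ (x : M) (V : TangentSpace 𝓘(ℝ, E) x),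
          S₂.efisher (f x) (mfderiv 𝓘(ℝ, E) 𝓘(ℝ, E) f x V) ≤ S₁.efisher x V ∧
          (2 ≤ k →
            S₂.fisher (f x) (mfderiv 𝓘(ℝ, E) 𝓘(ℝ, E) f x V)
              (mfderiv 𝓘(ℝ, E) 𝓘(ℝ, E) f x V) ≤ S₁.fisher x V V)) ∧
    ((InfoGeo.FiniteField.fisher.{u} k).IsLocalQuadratic ∧
      (InfoGeo.FiniteField.fisher.{u} k).IsWeaklyContinuous ∧
      (InfoGeo.FiniteField.fisher.{u} k).IsMonotone ∧
      ∀ F : InfoGeo.FiniteField.{u} k,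
        F.IsLocalQuadratic → F.IsWeaklyContinuous → F.IsMonotonePositive →
        ∃ c : ℝ, ∀ (E : Type u) [NormedAddCommGroup E] [NormedSpace ℝ E] [CompleteSpace E]
          (M : Type u) [TopologicalSpace M] [T3Space M] [ChartedSpace E M]
          [IsManifold 𝓘(ℝ, E) ∞ M] (n : ℕ) (S : InfoGeo.FiniteStatisticalModel k E M n)
          (x : M) (V W : TangentSpace 𝓘(ℝ, E) x),
          F E M n S x V W = c * S.toStatisticalModel.fisher x V W) := by
  refine ⟨?_, InfoGeo.FiniteField.isLocalQuadratic_fisher k,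
    InfoGeo.FiniteField.isWeaklyContinuous_fisher k, InfoGeo.FiniteField.isMonotone_fisher hk,
    fun F hF hc hm => InfoGeo.FiniteField.exists_eq_fisher hk hF hc hm⟩
  intro E _ _ _ M _ _ _ _ d₁ d₂ Ω₁ _ _ _ _ _ Ω₂ _ _ _ _ _ S₁ S₂ _ _ _ _ f T _ hT _ x V
  refine ⟨InfoGeo.StatisticalModel.efisher_le hk hT x V, fun h2k => ?_⟩
  exact InfoGeo.StatisticalModel.fisher_le hk hT x V
    (InfoGeo.StatisticalModel.integrable_sq_of_memLp h2k
      (InfoGeo.StatisticalModel.memLp_dlog x V))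
    (InfoGeo.StatisticalModel.integrable_sq_of_memLp h2k
      (InfoGeo.StatisticalModel.memLp_dlog (f x) _))
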